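/- A 3-graph $G=(V,E)$ consists of a finite vertex set $V$ and a set $E$ of 3-element subsets of $V$. A legal weighting of $G$ is a vector $(x_v)_{v\in V}$ of nonnegative reals with $\sum_{v\in V}x_v=1$, and the Lagrangian of $G$ is $$\lambda(G)=\max\Big\{\sum_{e\in E}\prod_{v\in e}x_v \;:\; x \text{ a legal weighting of } G\Big\}.$$ For an integer $m\ge 1$ let $\lambda_3(m)$ be the maximum of $\lambda(G)$ over all 3-graphs $G$ with exactly $m$ edges. Order the 3-element subsets of $\mathbb{N}$ colexicographically: for $A\neq B$, $A$ precedes $B$ if $\max(A\mathbin{\triangle}B)\in B$. For an integer $k\ge 1$ let $C_k$ be the 3-graph whose edges are the first $k$ sets in this order, and for a real number $y\ge 1$ put $C_y=C_{\lfloor y\rfloor}$. **Theorem.** There exists an absolute constant $c>0$ such that for every integer $m>0$, $$\lambda_3(m)\le \lambda\big(C_{m+cm^{2/9}}\big).$$ -/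

import Mathlib

open Finset

/-- A finite `r`-uniform hypergraph (an `r`-graph) with vertices taken from `α`: a finite set
`verts` of vertices and a set `edges` of `r`-element subsets of `verts`. -/
structure RGraph (α : Type*) (r : ℕ) where
  /-- the vertex set -/
  verts : Finset α
  /-- the edge set -/
  edges : Finset (Finset α)
  /-- every edge is an `r`-element subset of the vertex set -/
  edges_subset : edges ⊆ verts.powersetCard r

namespace RGraph

variable {α : Type*} {r : ℕ}

/-- The weight polynomial `w(G, x) = ∑_{e ∈ E} ∏_{i ∈ e} x_i`. -/
def weight (G : RGraph α r) (x : α → ℝ) : ℝ :=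
  ∑ e ∈ G.edges, ∏ i ∈ e, x i

/-- Legal weightings of `G`: nonnegative weights on the vertices of `G` with total weight `1`
(extended by `0` outside the vertex set). -/
def IsLegal (G : RGraph α r) (x : α → ℝ) : Prop :=
  (∀ i ∈ G.verts, 0 ≤ x i) ∧ (∀ i, i ∉ G.verts → x i = 0) ∧ ∑ i ∈ G.verts, x i = 1

/-- The Lagrangian `λ(G)`: the maximum of `w(G, x)` over all legal weightings `x`. -/
noncomputable def lagrangian (G : RGraph α r) : ℝ :=
  sSup (G.weight '' {x | G.IsLegal x})

/-- The supremum in the definition of the Lagrangian is a maximum. -/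
theorem isGreatest_lagrangian (G : RGraph α r) (hG : G.verts.Nonempty) :
    IsGreatest (G.weight '' {x | G.IsLegal x}) G.lagrangian := by
  classical
  have hsub : {x | G.IsLegal x} ⊆ Set.pi Set.univ (fun _ : α => Set.Icc (0 : ℝ) 1) := by
    rintro x ⟨h0, h1, h2⟩ i -
    by_cases hi : i ∈ G.verts
    · exact ⟨h0 i hi, h2 ▸ Finset.single_le_sum h0 hi⟩
    · simp [h1 i hi]
  have hclosed : IsClosed {x : α → ℝ | G.IsLegal x} := by
    have e : {x : α → ℝ | G.IsLegal x} =
        (⋂ i ∈ G.verts, {x : α → ℝ | 0 ≤ x i}) ∩ ((⋂ i, ⋂ (_ : i ∉ G.verts), {x : α → ℝ | x i = 0}) ∩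
          {x : α → ℝ | ∑ i ∈ G.verts, x i = 1}) := by
      ext x; simp [IsLegal]
    rw [e]
    refine IsClosed.inter ?_ (IsClosed.inter ?_ ?_)
    · exact isClosed_biInter fun i _ => isClosed_le continuous_const (continuous_apply i)
    · exact isClosed_iInter fun i => isClosed_iInter fun _ =>
        isClosed_eq (continuous_apply i) continuous_const
    · exact isClosed_eq (by fun_prop) continuous_const
  have hc : IsCompact {x : α → ℝ | G.IsLegal x} :=
    (isCompact_univ_pi fun _ => isCompact_Icc).of_isClosed_subset hclosed hsub
  have hw : Continuous G.weight := by unfold weight; fun_prop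
  obtain ⟨v, hv⟩ := hG
  refine (hc.image hw).isGreatest_sSup ⟨_, Set.mem_image_of_mem _ (x := Pi.single v 1) ?_⟩
  refine ⟨fun i _ => ?_, fun i hi => ?_, ?_⟩
  · by_cases h : i = v
    · subst h; simp
    · simp [h]
  · have : i ≠ v := by rintro rfl; exact hi hv
    simp [this]
  · simp [Pi.single_apply, hv]

/-- The Lagrangian is at most the number of edges. -/
theorem lagrangian_le_card (G : RGraph α r) : G.lagrangian ≤ #G.edges := by
  refine Real.sSup_le ?_ (Nat.cast_nonneg _)
  rintro _ ⟨x, ⟨h0, h1, h2⟩, rfl⟩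
  have hx : ∀ i ∈ G.verts, x i ≤ 1 := fun i hi => h2 ▸ Finset.single_le_sum h0 hi
  calc G.weight x ≤ ∑ _e ∈ G.edges, (1 : ℝ) := Finset.sum_le_sum fun e he => by
        have hs := (Finset.mem_powersetCard.1 (G.edges_subset he)).1
        exact Finset.prod_le_one (fun i hi => h0 i (hs hi)) fun i hi => hx i (hs hi)
    _ = #G.edges := by simp

end RGraph

/-- `λ_r(m)`: the maximum Lagrangian of an `r`-graph with exactly `m` edges
(vertices are labelled by natural numbers, which is no restriction for finite hypergraphs). -/
noncomputable def maxLagrangian (r m : ℕ) : ℝ :=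
  sSup {y : ℝ | ∃ H : RGraph ℕ r, #H.edges = m ∧ H.lagrangian = y}

/-- Every `r`-graph with `m` edges has Lagrangian at most `λ_r(m)`. -/
theorem lagrangian_le_maxLagrangian {r m : ℕ} (H : RGraph ℕ r) (hH : #H.edges = m) :
    H.lagrangian ≤ maxLagrangian r m := by
  refine le_csSup ⟨(m : ℝ), ?_⟩ ⟨H, hH, rfl⟩
  rintro _ ⟨G, hG, rfl⟩
  exact hG ▸ G.lagrangian_le_card

/-- The first `m` sets of `ℕ^(r)` in the colexicographic order, for `r ≥ 1`: those `r`-sets that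
are preceded by fewer than `m` others. These all lie inside `{0, …, m + r - 1}`. -/
def colexFirst (r m : ℕ) : Finset (Finset ℕ) :=
  {A ∈ (range (m + r)).powersetCard r |
    #{B ∈ (range (m + r)).powersetCard r | toColex B < toColex A} < m}

/-- `colexFirst r m` is closed under passing to smaller `r`-sets of `ℕ` in the colex order. -/
theorem isInitSeg_colexFirst (r m : ℕ) : Colex.IsInitSeg (colexFirst r m) r := by
  refine ⟨fun A hA => ?_, fun A B hA hB => ?_⟩
  · exact (mem_powersetCard.1 (mem_filter.1 (mem_coe.1 hA)).1).2
  · simp only [colexFirst, mem_filter, mem_powersetCard] at hA ⊢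
    refine ⟨⟨fun b hb => ?_, hB.2⟩, lt_of_le_of_lt (card_le_card fun D hD => ?_) hA.2⟩
    · exact mem_range.2 (Colex.forall_lt_mono hB.1.le (fun a ha => mem_range.1 (hA.1.1 ha)) b hb)
    · simp only [mem_filter] at hD ⊢
      exact ⟨hD.1, hD.2.trans hB.1⟩

/-- `colexFirst r m` has exactly `m` elements. -/
theorem card_colexFirst {r : ℕ} (hr : 1 ≤ r) (m : ℕ) : #(colexFirst r m) = m := by
  set F := (range (m + r)).powersetCard r with hF
  have hcard : m ≤ #F := by
    rw [hF, card_powersetCard, card_range]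
    obtain ⟨k, rfl⟩ : ∃ k, r = k + 1 := ⟨r - 1, by omega⟩
    induction m with
    | zero => exact Nat.zero_le _
    | succ n ih =>
      have h1 := Nat.choose_succ_succ (n + (k + 1)) k
      have h2 : 0 < (n + (k + 1)).choose k := Nat.choose_pos (by omega)
      have h3 := ih rfl
      rw [show n + 1 + (k + 1) = n + (k + 1) + 1 by ring, Nat.choose_succ_succ,
        Nat.succ_eq_add_one]
      omega
  let rk : Finset ℕ → ℕ := fun A => #{B ∈ F | toColex B < toColex A}
  have hlt : ∀ A ∈ F, ∀ B, toColex A < toColex B → rk A < rk B := by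
    intro A hA B hAB
    refine card_lt_card ⟨fun D hD => ?_, fun h => ?_⟩
    · simp only [mem_filter] at hD ⊢
      exact ⟨hD.1, hD.2.trans hAB⟩
    · have := h (mem_filter.2 ⟨hA, hAB⟩)
      simp at this
  have hinj : Set.InjOn rk F := by
    intro A hA B hB h
    rcases lt_trichotomy (toColex A) (toColex B) with h' | h' | h'
    · exact absurd h (hlt A hA B h').ne
    · simpa using h'
    · exact absurd h (hlt B hB A h').ne'
  have himg : F.image rk = range #F := by
    refine eq_of_subset_of_card_le (fun k hk => ?_) ?_
    · obtain ⟨A, hA, rfl⟩ := mem_image.1 hk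
      refine mem_range.2 (card_lt_card ⟨filter_subset _ _, fun h => ?_⟩)
      have := h hA
      simp at this
    · rw [card_range, card_image_of_injOn hinj]
  have h : (colexFirst r m).image rk = range m := by
    ext k
    simp only [mem_image, mem_range]
    constructor
    · rintro ⟨A, hA, rfl⟩
      exact (mem_filter.1 hA).2
    · intro hk
      have : k ∈ F.image rk := by rw [himg]; exact mem_range.2 (hk.trans_le hcard)
      obtain ⟨A, hA, rfl⟩ := mem_image.1 this
      exact ⟨A, mem_filter.2 ⟨hA, hk⟩, rfl⟩
  have hsub : colexFirst r m ⊆ F := filter_subset _ _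
  have hc := card_image_of_injOn (hinj.mono (coe_subset.2 hsub))
  rw [h, card_range] at hc
  exact hc.symm

/-- The `r`-graph `C_{r,m}` formed by the first `m` sets of `ℕ^(r)` in the colexicographic order
(its vertices are those covered by an edge). -/
def colexGraph (r m : ℕ) : RGraph ℕ r where
  verts := (colexFirst r m).biUnion id
  edges := colexFirst r m
  edges_subset := fun _ hA => mem_powersetCard.2
    ⟨subset_biUnion_of_mem id hA, (isInitSeg_colexFirst r m).1 (mem_coe.2 hA)⟩

/-! Choose `n` with `(n+1).choose 3 ≤ m < (n+2).choose 3` and put `t = n + 2`. An optimal weighting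
can be assumed to live on at most `t` vertices: either `λ(H)` is below the Lagrangian of the clique
on `t - 1` vertices, which a colex graph with at least `m` edges already attains, or the first-order
optimality conditions force the weights to be nearly uniform, and `card_support_le` bounds the
support.

Sort the weights increasingly, with smallest values `a ≤ b` and `s = a + b`. Compared with levelling
the other `n` weights to `ρ = (1 - s)/n`, the full clique loses at least a multiple of the sum of
the squared deviations (`sum_prod_le_cliqueWeight`). The `p` missing triples weigh at least as much
as some down-closed family of `p` triples (`exists_downClosed_triples`), and each of those weighs at
least `a * b` times the weight of its largest vertex. In a down-closed family of `O(t)` triples only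
`O(t^(2/3))` share a largest vertex (`card_fiber_of_downClosed`), so the loss is about `a * b * p *
ρ`. The discrepancy is absorbed by the squared deviations, up to the value of `O(t^(2/3))` triples
(`sum_prod_le_of_sorted`).

The resulting bound is at most the weight of a colex initial segment under the weighting `ρ, …, ρ,
s/2, s/2`, at the price of `O(t^(2/3)) = O(m^(2/9))` extra edges (`brokenWeight_le_lagrangian`).
Small `m` are absorbed into the constant. -/

/-! ### Elementary symmetric sums through power sums. -/

theorem sum_powersetCard_one_prod {α : Type*} [DecidableEq α] (S : Finset α) (x : α → ℝ) :
    ∑ e ∈ S.powersetCard 1, ∏ i ∈ e, x i = ∑ i ∈ S, x i := by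
  simp [powersetCard_one]

theorem sum_powersetCard_insert_prod {α : Type*} [DecidableEq α] {S : Finset α} {a : α}
    (ha : a ∉ S) (k : ℕ) (x : α → ℝ) :
    ∑ e ∈ (insert a S).powersetCard (k + 1), ∏ i ∈ e, x i =
      ∑ e ∈ S.powersetCard (k + 1), ∏ i ∈ e, x i + x a * ∑ e ∈ S.powersetCard k, ∏ i ∈ e, x i := by
  have hn : ∀ e ∈ S.powersetCard k, a ∉ e := fun e he h => ha ((mem_powersetCard.1 he).1 h)
  rw [powersetCard_succ_insert ha, sum_union, sum_image, mul_sum]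
  · exact congrArg _ (sum_congr rfl fun e he => prod_insert (hn e he))
  · intro e he f hf h
    rw [← erase_insert (hn e he), ← erase_insert (hn f hf), h]
  · rw [disjoint_left]
    intro e he h
    obtain ⟨f, -, rfl⟩ := mem_image.1 h
    exact ha ((mem_powersetCard.1 he).1 (mem_insert_self _ _))

theorem sum_powersetCard_two_prod {α : Type*} [DecidableEq α] (S : Finset α) (x : α → ℝ) :
    ∑ e ∈ S.powersetCard 2, ∏ i ∈ e, x i = ((∑ i ∈ S, x i) ^ 2 - ∑ i ∈ S, x i ^ 2) / 2 := by
  induction S using Finset.induction_on with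
  | empty => rw [powersetCard_eq_empty.2 (by simp)]; simp
  | insert a S ha ih =>
    rw [sum_powersetCard_insert_prod ha 1, ih, sum_powersetCard_one_prod, sum_insert ha,
      sum_insert ha]
    ring

theorem sum_powersetCard_three_prod {α : Type*} [DecidableEq α] (S : Finset α) (x : α → ℝ) :
    ∑ e ∈ S.powersetCard 3, ∏ i ∈ e, x i =
      ((∑ i ∈ S, x i) ^ 3 - 3 * (∑ i ∈ S, x i) * (∑ i ∈ S, x i ^ 2) + 2 * ∑ i ∈ S, x i ^ 3) / 6 := by
  induction S using Finset.induction_on with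
  | empty => rw [powersetCard_eq_empty.2 (by simp)]; simp
  | insert a S ha ih =>
    rw [sum_powersetCard_insert_prod ha 2, ih, sum_powersetCard_two_prod, sum_insert ha,
      sum_insert ha, sum_insert ha]
    ring

theorem sum_powersetCard_three_prod_le {α : Type*} [DecidableEq α] (S : Finset α) (x : α → ℝ)
    (hx : ∀ i ∈ S, 0 ≤ x i) :
    ∑ e ∈ S.powersetCard 3, ∏ i ∈ e, x i ≤ (∑ i ∈ S, x i) ^ 3 / 6 := by
  have h : ∑ i ∈ S, x i ^ 3 ≤ (∑ i ∈ S, x i) * ∑ i ∈ S, x i ^ 2 := by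
    rw [mul_sum]
    refine sum_le_sum fun i hi => ?_
    nlinarith [mul_le_mul_of_nonneg_right (single_le_sum hx hi) (sq_nonneg (x i))]
  have h0 : 0 ≤ (∑ i ∈ S, x i) * ∑ i ∈ S, x i ^ 2 :=
    mul_nonneg (sum_nonneg hx) (sum_nonneg fun i _ => sq_nonneg _)
  rw [sum_powersetCard_three_prod]
  nlinarith

/-! ### Down-closed families of triples. -/

/-- The strictly increasing triples of natural numbers below `t`. -/
def triples (t : ℕ) : Finset (ℕ × ℕ × ℕ) :=
  {q ∈ range t ×ˢ range t ×ˢ range t | q.1 < q.2.1 ∧ q.2.1 < q.2.2}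

theorem mem_triples {t : ℕ} {q : ℕ × ℕ × ℕ} :
    q ∈ triples t ↔ q.1 < q.2.1 ∧ q.2.1 < q.2.2 ∧ q.2.2 < t := by
  simp only [triples, mem_filter, mem_product, mem_range]
  omega

/-- The set of entries of a triple. -/
def tripleSet (q : ℕ × ℕ × ℕ) : Finset ℕ := {q.1, q.2.1, q.2.2}

theorem prod_tripleSet {t : ℕ} {q : ℕ × ℕ × ℕ} (hq : q ∈ triples t) (x : ℕ → ℝ) :
    ∏ i ∈ tripleSet q, x i = x q.1 * x q.2.1 * x q.2.2 := by
  obtain ⟨h1, h2, h3⟩ := mem_triples.1 hq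
  rw [tripleSet, prod_insert (by simp; omega), prod_insert (by simp; omega), prod_singleton,
    mul_assoc]

theorem injOn_tripleSet (t : ℕ) : Set.InjOn tripleSet (triples t) := by
  rintro ⟨c, b, a⟩ h ⟨c', b', a'⟩ h' he
  have h := mem_triples.1 h
  have h' := mem_triples.1 h'
  simp only [tripleSet, Finset.ext_iff, mem_insert, mem_singleton] at he h h'
  have e1 := he c; have e2 := he b; have e3 := he a
  have f1 := he c'; have f2 := he b'; have f3 := he a'
  simp only [Prod.mk.injEq]
  simp at e1 e2 e3 f1 f2 f3
  omega

theorem image_tripleSet (t : ℕ) : (triples t).image tripleSet = (range t).powersetCard 3 := by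
  ext e
  simp only [mem_image, mem_powersetCard]
  constructor
  · rintro ⟨q, hq, rfl⟩
    obtain ⟨h1, h2, h3⟩ := mem_triples.1 hq
    refine ⟨fun i hi => ?_, ?_⟩
    · simp only [tripleSet, mem_insert, mem_singleton] at hi
      rw [mem_range]; omega
    · rw [tripleSet, card_insert_of_notMem (by simp; omega), card_insert_of_notMem (by simp; omega),
        card_singleton]
  · rintro ⟨hs, hc⟩
    let f := e.orderEmbOfFin hc
    have hf : ∀ i, f i < t := fun i => mem_range.1 (hs (e.orderEmbOfFin_mem hc i))
    refine ⟨(f 0, f 1, f 2), mem_triples.2 ⟨f.strictMono (by decide), f.strictMono (by decide),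
      hf 2⟩, ?_⟩
    have h : Finset.univ.image f = e := by
      rw [← coe_inj, coe_image, coe_univ, Set.image_univ]
      exact e.range_orderEmbOfFin hc
    rw [← h]
    ext i
    simp [tripleSet, Fin.exists_fin_succ, eq_comm]

theorem card_triples (t : ℕ) : #(triples t) = t.choose 3 := by
  rw [← card_image_of_injOn (injOn_tripleSet t), image_tripleSet, card_powersetCard, card_range]

/-- Among the sets of `p` triples there is one of minimal weight that is closed downwards. -/
theorem exists_downClosed_triples {t p : ℕ} {x : ℕ → ℝ} (h0 : ∀ i < t, 0 ≤ x i)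
    (hx : ∀ i j, i ≤ j → j < t → x i ≤ x j) {U : Finset (ℕ × ℕ × ℕ)} (hU : U ⊆ triples t)
    (hp : p ≤ #U) :
    ∃ T ⊆ triples t, #T = p ∧
      ∑ q ∈ T, x q.1 * x q.2.1 * x q.2.2 ≤ ∑ q ∈ U, x q.1 * x q.2.1 * x q.2.2 ∧
      ∀ q ∈ T, ∀ q' ∈ triples t, q' ≤ q → q' ∈ T := by
  let w : ℕ × ℕ × ℕ → ℝ := fun q => x q.1 * x q.2.1 * x q.2.2
  let W : Finset (ℕ × ℕ × ℕ) → ℝ := fun T => ∑ q ∈ T, w q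
  have hw : ∀ q ∈ triples t, 0 ≤ w q := fun q hq => by
    obtain ⟨h1, h2, h3⟩ := mem_triples.1 hq
    exact mul_nonneg (mul_nonneg (h0 _ (by omega)) (h0 _ (by omega))) (h0 _ h3)
  obtain ⟨U', hU', hcU⟩ := exists_subset_card_eq hp
  have hne : ((triples t).powersetCard p).Nonempty :=
    ⟨U', mem_powersetCard.2 ⟨hU'.trans hU, hcU⟩⟩
  obtain ⟨T₀, hT₀, hmin⟩ := exists_min_image _ W hne
  -- Ties in weight are broken by the total of all entries: replacing a triple by a smaller missing
  -- one never raises the weight and strictly lowers this total.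
  obtain ⟨T, hT, hmin'⟩ := exists_min_image {T ∈ (triples t).powersetCard p | W T = W T₀}
    (fun T => ∑ q ∈ T, (q.1 + q.2.1 + q.2.2)) ⟨T₀, mem_filter.2 ⟨hT₀, rfl⟩⟩
  obtain ⟨hT, hWT⟩ := mem_filter.1 hT
  obtain ⟨hTs, hTc⟩ := mem_powersetCard.1 hT
  refine ⟨T, hTs, hTc, ?_, fun q hq q' hq' hle => ?_⟩
  · calc W T ≤ W U' := hWT ▸ hmin U' (mem_powersetCard.2 ⟨hU'.trans hU, hcU⟩)
      _ ≤ W U := sum_le_sum_of_subset_of_nonneg hU' fun q hq _ => hw q (hU hq)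
  · by_contra hn
    have hne' : q' ≠ q := fun h => hn (h ▸ hq)
    have hn' : q' ∉ T.erase q := fun h => hn (mem_of_mem_erase h)
    have hmem : insert q' (T.erase q) ∈ (triples t).powersetCard p := by
      refine mem_powersetCard.2 ⟨insert_subset hq' ((erase_subset _ _).trans hTs), ?_⟩
      rw [card_insert_of_notMem hn', card_erase_add_one hq, hTc]
    obtain ⟨k1, k2, k3⟩ := mem_triples.1 (hTs hq)
    obtain ⟨l1, l2, l3⟩ := mem_triples.1 hq'
    obtain ⟨g1, g2, g3⟩ : q'.1 ≤ q.1 ∧ q'.2.1 ≤ q.2.1 ∧ q'.2.2 ≤ q.2.2 := hle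
    have hwle : w q' ≤ w q := by
      have i1 := hx _ _ g1 (by omega)
      have i2 := hx _ _ g2 (by omega)
      have i3 := hx _ _ g3 k3
      have := h0 q'.1 (by omega)
      have := h0 q'.2.1 (by omega)
      have := h0 q'.2.2 (by omega)
      exact mul_le_mul (mul_le_mul i1 i2 (by assumption) (by linarith)) i3 (by assumption)
        (mul_nonneg (by linarith) (by linarith))
    have hW : W (insert q' (T.erase q)) ≤ W T := by
      simp only [W]
      rw [sum_insert hn', ← add_sum_erase T w hq]
      linarith
    have h1 := hmin' _ (mem_filter.2 ⟨hmem, le_antisymm (hW.trans hWT.le) (hmin _ hmem)⟩)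
    rw [sum_insert hn', ← add_sum_erase T _ hq] at h1
    have : q'.1 + q'.2.1 + q'.2.2 ≠ q.1 + q.2.1 + q.2.2 := fun h =>
      hne' (Prod.ext (by omega) (Prod.ext (by omega) (by omega)))
    omega

/-- Split the triples with largest entry `i` by the gap to the middle entry. Small gaps leave at
most `L * L` choices, since the smallest entry is below `L`. For a large gap the top entry can be
lowered by `0, …, L - 1` within `T`, so such triples number at most `#T / L`. -/
theorem card_fiber_of_downClosed {t L : ℕ} {T : Finset (ℕ × ℕ × ℕ)} (hT : T ⊆ triples t)
    (hd : ∀ q ∈ T, ∀ q' ∈ triples t, q' ≤ q → q' ∈ T) (hL : #T < (L + 1).choose 3) (i : ℕ) :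
    L * #{q ∈ T | q.2.2 = i} ≤ L * (L * L) + #T := by
  -- A triple with smallest entry at least `L` dominates every triple from `{0, …, L}`, and there
  -- are too many of those.
  have hlt : ∀ q ∈ T, q.1 < L := by
    intro q hq
    by_contra! h
    refine (card_le_card (s := triples (L + 1)) fun q' hq' => ?_).not_gt (card_triples _ ▸ hL)
    obtain ⟨l1, l2, l3⟩ := mem_triples.1 hq'
    obtain ⟨k1, k2, k3⟩ := mem_triples.1 (hT hq)
    refine hd q hq q' (mem_triples.2 ⟨l1, l2, by omega⟩) ⟨?_, ?_, ?_⟩ <;> omega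
  have hnear : #{q ∈ {q ∈ T | q.2.2 = i} | i - q.2.1 ≤ L} ≤ L * L := by
    have h : #(range L ×ˢ range L) = L * L := by simp
    rw [← h]
    refine card_le_card_of_injOn (fun q => (q.1, i - q.2.1 - 1)) (fun q hq => ?_) ?_
    · simp only [coe_filter, Set.mem_ofPred_eq, mem_filter] at hq
      obtain ⟨k1, k2, k3⟩ := mem_triples.1 (hT hq.1.1)
      have := hlt q hq.1.1
      simp
      omega
    · rintro ⟨c, b, a⟩ hq ⟨c', b', a'⟩ hq' h
      simp only [coe_filter, Set.mem_ofPred_eq, mem_filter, Prod.mk.injEq] at hq hq' h ⊢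
      have k := mem_triples.1 (hT hq.1.1)
      have k' := mem_triples.1 (hT hq'.1.1)
      simp only at k k'
      omega
  have hfar : L * #{q ∈ {q ∈ T | q.2.2 = i} | ¬ i - q.2.1 ≤ L} ≤ #T := by
    set F : Finset (ℕ × ℕ × ℕ) := {q ∈ {q ∈ T | q.2.2 = i} | ¬ i - q.2.1 ≤ L}
    have h : #(range L ×ˢ F) = L * #F := by simp
    rw [← h]
    refine card_le_card_of_injOn (fun z => (z.2.1, z.2.2.1, i - z.1)) ?_ ?_
    · rintro ⟨j, q⟩ hz
      simp only [F, coe_product, Set.mem_prod, mem_coe, mem_range, mem_filter] at hz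
      obtain ⟨k1, k2, k3⟩ := mem_triples.1 (hT hz.2.1.1)
      refine hd q hz.2.1.1 _ (mem_triples.2 ⟨?_, ?_, ?_⟩) ⟨?_, ?_, ?_⟩ <;> simp only <;> omega
    · rintro ⟨j, c, b, a⟩ hz ⟨j', c', b', a'⟩ hz' h
      simp only [F, coe_product, Set.mem_prod, mem_coe, mem_range, mem_filter,
        Prod.mk.injEq] at hz hz' h ⊢
      omega
  rw [← card_filter_add_card_filter_not (s := {q ∈ T | q.2.2 = i}) (fun q => i - q.2.1 ≤ L), mul_add]
  exact add_le_add (Nat.mul_le_mul_left _ hnear) hfar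

theorem cast_choose_three (n : ℕ) : (n.choose 3 : ℝ) = n * (n - 1) * (n - 2) / 6 := by
  induction n with
  | zero => simp
  | succ n ih =>
    rw [Nat.choose_succ_succ, Nat.cast_add, ih, Nat.cast_choose_two]
    push_cast
    ring

/-! ### Upper bound for increasing weights. -/

/-- The weight of the complete `3`-graph whose vertex weights are `s` and `n` equal ones,
with total weight `1`. -/
noncomputable def cliqueWeight (n : ℕ) (s : ℝ) : ℝ :=
  (1 - 3 * (s ^ 2 + n * ((1 - s) / n) ^ 2) + 2 * (s ^ 3 + n * ((1 - s) / n) ^ 3)) / 6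

theorem sum_range_add_two (n : ℕ) (f : ℕ → ℝ) :
    ∑ i ∈ range (n + 2), f i = ∑ i ∈ range n, f (i + 2) + f 1 + f 0 := by
  rw [sum_range_succ', sum_range_succ']

/-- Merging the first two weights and levelling the others. -/
theorem sum_prod_le_cliqueWeight {n : ℕ} (hn : 12 ≤ n) {x : ℕ → ℝ} (h0 : ∀ i < n + 2, 0 ≤ x i)
    (h1 : ∑ i ∈ range (n + 2), x i = 1) :
    ∑ e ∈ (range (n + 2)).powersetCard 3, ∏ i ∈ e, x i ≤
      cliqueWeight n (x 0 + x 1) + x 0 * x 1 * (1 - (x 0 + x 1)) -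
        (∑ i ∈ range n, (x (i + 2) - (1 - (x 0 + x 1)) / n) ^ 2) / 12 := by
  have hn' : (12 : ℝ) ≤ n := by exact_mod_cast hn
  rw [sum_powersetCard_three_prod, h1, sum_range_add_two, sum_range_add_two n (fun i => x i ^ 3)]
  rw [sum_range_add_two] at h1
  have hle : ∀ i ∈ range n, x (i + 2) ≤ 1 := fun i hi => by
    have h := single_le_sum (f := fun i => x (i + 2))
      (fun j hj => h0 _ (by have := mem_range.1 hj; omega)) hi
    have := h0 0 (by omega)
    have := h0 1 (by omega)
    linarith
  have ha := h0 0 (by omega)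
  have hb := h0 1 (by omega)
  have hs : 0 ≤ 1 - (x 0 + x 1) := by
    have : 0 ≤ ∑ i ∈ range n, x (i + 2) :=
      sum_nonneg fun j hj => h0 _ (by have := mem_range.1 hj; omega)
    linarith
  unfold cliqueWeight
  set a := x 0
  set b := x 1
  set ρ : ℝ := (1 - (a + b)) / n with hρ
  have hnρ : n * ρ = 1 - (a + b) := by rw [hρ]; field_simp
  have hρ0 : 0 ≤ ρ := by positivity
  -- This makes the coefficient of the squared deviations, divided by 6, at most `(-3 + 6/12 + 2)/6
  -- = -1/12`; the `2` comes from bounding the cubes by the squares.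
  have hρ1 : ρ ≤ 1 / 12 := by
    by_contra! h
    nlinarith
  set d : ℕ → ℝ := fun i => x (i + 2) - ρ with hd
  have D1 : ∑ i ∈ range n, d i = 0 := by
    simp only [hd, sum_sub_distrib, sum_const, card_range, nsmul_eq_mul, hnρ]
    linarith
  have R2 : ∑ i ∈ range n, x (i + 2) ^ 2 = n * ρ ^ 2 + ∑ i ∈ range n, d i ^ 2 := by
    have : ∀ i ∈ range n, x (i + 2) ^ 2 = ρ ^ 2 + 2 * ρ * d i + d i ^ 2 := fun i _ => by
      simp only [hd]; ring
    rw [sum_congr rfl this, sum_add_distrib, sum_add_distrib, ← mul_sum, D1]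
    simp
  have R3 : ∑ i ∈ range n, x (i + 2) ^ 3 =
      n * ρ ^ 3 + 3 * ρ * ∑ i ∈ range n, d i ^ 2 + ∑ i ∈ range n, d i ^ 3 := by
    have : ∀ i ∈ range n, x (i + 2) ^ 3 = ρ ^ 3 + 3 * ρ ^ 2 * d i + 3 * ρ * d i ^ 2 + d i ^ 3 :=
      fun i _ => by simp only [hd]; ring
    rw [sum_congr rfl this, sum_add_distrib, sum_add_distrib, sum_add_distrib, ← mul_sum,
      ← mul_sum, D1]
    simp
  have D3 : ∑ i ∈ range n, d i ^ 3 ≤ ∑ i ∈ range n, d i ^ 2 := by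
    refine sum_le_sum fun i hi => ?_
    have : d i ≤ 1 := by simp only [hd]; linarith [hle i hi]
    nlinarith [sq_nonneg (d i)]
  have D2 : 0 ≤ ∑ i ∈ range n, d i ^ 2 := sum_nonneg fun i _ => sq_nonneg _
  rw [R2, R3]
  change _ ≤ _ - (∑ i ∈ range n, d i ^ 2) / 12
  nlinarith [mul_le_mul_of_nonneg_right hρ1 D2]

/-- The main estimate: the weight of a `3`-graph missing at least `p` triples, for increasing
vertex weights. -/
theorem sum_prod_le_of_sorted {n p u : ℕ} (hn : 12 ≤ n) {x : ℕ → ℝ}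
    (h0 : ∀ i < n + 2, 0 ≤ x i) (hx : ∀ i j, i ≤ j → j < n + 2 → x i ≤ x j)
    (h1 : ∑ i ∈ range (n + 2), x i = 1) {E : Finset (Finset ℕ)}
    (hE : E ⊆ (range (n + 2)).powersetCard 3) (hpE : p + #E ≤ (n + 2).choose 3)
    (hp : p ≤ 2 * (n + 2)) (hu : n + 2 ≤ u ^ 3) :
    ∑ e ∈ E, ∏ i ∈ e, x i ≤ cliqueWeight n (x 0 + x 1) +
      x 0 * x 1 * (1 - (x 0 + x 1)) * (1 - ((p - 120 * u ^ 2 : ℕ) : ℝ) / n) := by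
  have hn' : (12 : ℝ) ≤ n := by exact_mod_cast hn
  have hu0 : 0 < u := by
    rcases Nat.eq_zero_or_pos u with rfl | h
    · simp at hu
    · exact h
  have hclique := sum_prod_le_cliqueWeight hn h0 h1
  have ha := h0 0 (by omega)
  have hb := h0 1 (by omega)
  have hst : (x 0 + x 1) * (n + 2) ≤ 2 := by
    have h : ∑ i ∈ range n, x 1 ≤ ∑ i ∈ range n, x (i + 2) := sum_le_sum fun i hi =>
      hx _ _ (by omega) (by have := mem_range.1 hi; omega)
    have := hx 0 1 (by omega) (by omega)
    rw [sum_range_add_two] at h1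
    simp only [sum_const, card_range, nsmul_eq_mul] at h
    nlinarith
  set U : Finset (ℕ × ℕ × ℕ) := {q ∈ triples (n + 2) | tripleSet q ∉ E} with hU
  have himU : U.image tripleSet = (range (n + 2)).powersetCard 3 \ E := by
    rw [← image_tripleSet]
    ext e
    simp only [hU, mem_image, mem_filter, mem_sdiff]
    constructor
    · rintro ⟨q, ⟨hq, hqE⟩, rfl⟩
      exact ⟨⟨q, hq, rfl⟩, hqE⟩
    · rintro ⟨⟨q, hq, rfl⟩, hqE⟩
      exact ⟨q, ⟨hq, hqE⟩, rfl⟩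
  have hinjU : Set.InjOn tripleSet U :=
    (injOn_tripleSet (n + 2)).mono (coe_subset.2 (filter_subset _ _))
  have hcU : p ≤ #U := by
    rw [← card_image_of_injOn hinjU, himU, card_sdiff_of_subset hE, card_powersetCard, card_range]
    omega
  have hwU : ∑ e ∈ E, ∏ i ∈ e, x i = ∑ e ∈ (range (n + 2)).powersetCard 3, ∏ i ∈ e, x i -
      ∑ q ∈ U, x q.1 * x q.2.1 * x q.2.2 := by
    rw [← sum_sdiff hE, ← himU, sum_image hinjU,
      sum_congr rfl fun q hq => prod_tripleSet (mem_filter.1 hq).1 x]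
    ring
  rw [hwU]
  have hs1 : x 0 + x 1 ≤ 1 / 2 := by nlinarith
  have hab0 : 0 ≤ x 0 * x 1 := mul_nonneg ha hb
  -- Here the truncated subtraction gives `0`, and the missing triples can be ignored.
  by_cases hpr : p ≤ 120 * u ^ 2
  · have hU0 : 0 ≤ ∑ q ∈ U, x q.1 * x q.2.1 * x q.2.2 := sum_nonneg fun q hq => by
      obtain ⟨k1, k2, k3⟩ := mem_triples.1 (mem_filter.1 hq).1
      exact mul_nonneg (mul_nonneg (h0 _ (by omega)) (h0 _ (by omega))) (h0 _ k3)
    have hD : 0 ≤ ∑ i ∈ range n, (x (i + 2) - (1 - (x 0 + x 1)) / n) ^ 2 :=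
      sum_nonneg fun i _ => sq_nonneg _
    rw [Nat.sub_eq_zero_of_le hpr]
    simp only [Nat.cast_zero, zero_div, sub_zero, mul_one]
    linarith
  obtain ⟨T, hT, hTc, hTw, hTd⟩ := exists_downClosed_triples h0 hx (filter_subset _ _) hcU
  set N : ℕ → ℕ := fun i => #{q ∈ T | q.2.2 = i} with hN
  -- Taking `L = 3 * u`, of order the cube root of `t`, balances the two contributions `L * L` and
  -- `#T / L`; here `#T ≤ 2 * u ^ 3`.
  have hNle : ∀ i, N i ≤ 10 * u ^ 2 := by
    intro i
    have h : #T < (3 * u + 1).choose 3 := by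
      have h3 : (2 * u ^ 3 : ℝ) < ((3 * u + 1).choose 3 : ℕ) := by
        rw [cast_choose_three]
        push_cast
        have : (1 : ℝ) ≤ u := by exact_mod_cast hu0
        nlinarith [pow_pos (zero_lt_one.trans_le this) 3, one_le_pow₀ this (n := 2),
          mul_le_mul_of_nonneg_left (one_le_pow₀ this (n := 2)) (zero_le_one.trans this)]
      have h3 : 2 * u ^ 3 < (3 * u + 1).choose 3 := by exact_mod_cast h3
      omega
    have h := card_fiber_of_downClosed hT hTd h i
    have h' : 3 * u * N i ≤ 3 * u * (10 * u ^ 2) := by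
      simp only [hN]
      refine h.trans ?_
      have e1 : 3 * u * (3 * u * (3 * u)) = 27 * u ^ 3 := by ring
      have e2 : 3 * u * (10 * u ^ 2) = 30 * u ^ 3 := by ring
      rw [e1, e2]
      omega
    exact Nat.le_of_mul_le_mul_left h' (by omega)
  have hmaps : ∀ q ∈ T, q.2.2 ∈ range (n + 2) := fun q hq =>
    mem_range.2 (mem_triples.1 (hT hq)).2.2
  have hN01 : N 0 = 0 ∧ N 1 = 0 := by
    simp only [hN, card_eq_zero, filter_eq_empty_iff]
    constructor <;> intro q hq <;> have := mem_triples.1 (hT hq) <;> omega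
  have hNsum : ∑ i ∈ range n, (N (i + 2) : ℝ) = p := by
    have h := sum_range_add_two n (fun i => (N i : ℝ))
    rw [← Nat.cast_sum, ← card_eq_sum_card_fiberwise hmaps, hTc, hN01.1, hN01.2] at h
    simpa using h.symm
  have hNx : ∑ q ∈ T, x q.2.2 = ∑ i ∈ range n, N (i + 2) * x (i + 2) := by
    have h := sum_range_add_two n (fun i => N i * x i)
    rw [hN01.1, hN01.2] at h
    simp only [Nat.cast_zero, zero_mul, add_zero] at h
    rw [← h, ← sum_fiberwise_of_maps_to hmaps]
    refine sum_congr rfl fun i _ => ?_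
    rw [sum_congr rfl (g := fun _ => x i) fun q hq => by rw [(mem_filter.1 hq).2]]
    simp [hN]
  have hTx : x 0 * x 1 * ∑ q ∈ T, x q.2.2 ≤ ∑ q ∈ T, x q.1 * x q.2.1 * x q.2.2 := by
    rw [mul_sum]
    refine sum_le_sum fun q hq => ?_
    obtain ⟨k1, k2, k3⟩ := mem_triples.1 (hT hq)
    have i1 := hx 0 q.1 (by omega) (by omega)
    have i2 := hx 1 q.2.1 (by omega) (by omega)
    exact mul_le_mul_of_nonneg_right (mul_le_mul i1 i2 hb (ha.trans i1)) (h0 _ k3)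
  set s := x 0 + x 1 with hs
  set ab := x 0 * x 1 with hab
  set ρ : ℝ := (1 - s) / n with hρ
  have hNd : ∑ i ∈ range n, (N (i + 2) : ℝ) * x (i + 2) =
      p * ρ + ∑ i ∈ range n, N (i + 2) * (x (i + 2) - ρ) := by
    rw [← hNsum, sum_mul, ← sum_add_distrib]
    exact sum_congr rfl fun i _ => by ring
  -- Completing the square with `d = x (i + 2) - ρ`: `d² / 12 + ab * N * d ≥ -3 * ab² * N²`, and `N²
  -- ≤ 10 * u² * N`.
  have hquad : -(3 * ab ^ 2 * (10 * u ^ 2 * p)) ≤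
      (∑ i ∈ range n, (x (i + 2) - ρ) ^ 2) / 12 +
        ab * ∑ i ∈ range n, N (i + 2) * (x (i + 2) - ρ) := by
    rw [← hNsum, mul_sum, mul_sum, mul_sum, sum_div, ← sum_add_distrib, ← sum_neg_distrib]
    refine sum_le_sum fun i _ => ?_
    have h1 : (N (i + 2) : ℝ) ≤ 10 * u ^ 2 := by exact_mod_cast hNle (i + 2)
    have h2 : (N (i + 2) : ℝ) * N (i + 2) ≤ 10 * u ^ 2 * N (i + 2) :=
      mul_le_mul_of_nonneg_right h1 (Nat.cast_nonneg _)
    nlinarith [mul_le_mul_of_nonneg_left h2 (sq_nonneg ab),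
      sq_nonneg ((x (i + 2) - ρ) + 6 * ab * N (i + 2))]
  have hab1 : ab * (n + 2) ^ 2 ≤ 1 := by
    have h4 : 4 * ab ≤ s ^ 2 := by
      have : s ^ 2 - 4 * ab = (x 0 - x 1) ^ 2 := by rw [hs, hab]; ring
      linarith [sq_nonneg (x 0 - x 1)]
    have h5 : (s * (n + 2)) ^ 2 ≤ 2 ^ 2 :=
      pow_le_pow_left₀ (mul_nonneg (add_nonneg ha hb) (by linarith)) hst 2
    have h6 := mul_le_mul_of_nonneg_right h4 (sq_nonneg ((n : ℝ) + 2))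
    linarith
  -- The error is worth at most `120 * u ^ 2` triples of weight `ab * ρ`, because `ab * p ≤ 4 * ρ`.
  have herr : 3 * ab ^ 2 * (10 * u ^ 2 * p) ≤ ab * (120 * u ^ 2 * ρ) := by
    have hp' : (p : ℝ) ≤ 2 * (n + 2) := by exact_mod_cast hp
    have k2 : 0 ≤ ρ := div_nonneg (by linarith) (by linarith)
    have hρn : 1 / 2 ≤ ρ * n := by
      rw [hρ, div_mul_cancel₀ _ (by linarith)]
      linarith
    have k1 : ab * p * (n + 2) ≤ 2 := by
      have := mul_le_mul_of_nonneg_left hp' (mul_nonneg hab0 (by linarith : (0 : ℝ) ≤ n + 2))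
      linarith
    have e1 : ab * p ≤ 4 * ρ := by
      refine le_of_mul_le_mul_right (k1.trans ?_) (by linarith : (0 : ℝ) < n + 2)
      linarith
    have := mul_le_mul_of_nonneg_left e1 (mul_nonneg hab0 (sq_nonneg (u : ℝ)))
    linarith
  have hcast : ((p - 120 * u ^ 2 : ℕ) : ℝ) = p - 120 * u ^ 2 := by
    rw [Nat.cast_sub (by omega)]; push_cast; ring
  have hfin : ab * (1 - s) * (1 - (p - 120 * u ^ 2 : ℝ) / n) =
      ab * (1 - s) - ab * (p * ρ) + ab * (120 * u ^ 2 * ρ) := by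
    rw [hρ]; field_simp; ring
  rw [hcast, hfin]
  rw [hNx, hNd, mul_add] at hTx
  linarith

/-! ### Relabelling vertices by increasing weight. -/

theorem exists_sorted_relabelling {S : Finset ℕ} {t : ℕ} (hS : #S = t) (x : ℕ → ℝ)
    {E : Finset (Finset ℕ)} (hE : E ⊆ S.powersetCard 3) :
    ∃ f : ℕ → ℕ, (range t).image f = S ∧ Set.InjOn f (range t) ∧
      (∀ i j, i ≤ j → j < t → x (f i) ≤ x (f j)) ∧
      ∃ E' ⊆ (range t).powersetCard 3, #E' = #E ∧
        ∑ e ∈ E', ∏ i ∈ e, x (f i) = ∑ e ∈ E, ∏ i ∈ e, x i := by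
  let g := S.orderEmbOfFin hS
  let σ := Tuple.sort (fun i => x (g i))
  let f : ℕ → ℕ := fun i => if h : i < t then g (σ ⟨i, h⟩) else 0
  have hf : ∀ i (h : i < t), f i = g (σ ⟨i, h⟩) := fun i h => dif_pos h
  have hmem : ∀ i < t, f i ∈ S := fun i h => hf i h ▸ S.orderEmbOfFin_mem hS _
  have hinj : Set.InjOn f (range t) := by
    intro i hi j hj h
    have hi := mem_range.1 hi
    have hj := mem_range.1 hj
    rw [hf i hi, hf j hj] at h
    simpa using σ.injective (g.injective h)
  have himg : (range t).image f = S := by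
    refine eq_of_subset_of_card_le (fun k hk => ?_) ?_
    · obtain ⟨i, hi, rfl⟩ := mem_image.1 hk
      exact hmem i (mem_range.1 hi)
    · rw [card_image_of_injOn hinj, card_range, hS]
  refine ⟨f, himg, hinj, fun i j hij hj => ?_,
    {e ∈ (range t).powersetCard 3 | e.image f ∈ E}, filter_subset _ _, ?_⟩
  · rw [hf i (hij.trans_lt hj), hf j hj]
    exact Tuple.monotone_sort (fun i => x (g i)) (show (⟨i, _⟩ : Fin t) ≤ ⟨j, hj⟩ from hij)
  · have hI : Set.InjOn (image f) ({e ∈ (range t).powersetCard 3 | e.image f ∈ E} :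
        Finset (Finset ℕ)) := by
      intro e he e' he' h
      have he := (mem_powersetCard.1 (mem_filter.1 (mem_coe.1 he)).1).1
      have he' := (mem_powersetCard.1 (mem_filter.1 (mem_coe.1 he')).1).1
      have h : f '' e = f '' e' := by rw [← coe_image, ← coe_image, h]
      exact coe_inj.1 ((hinj.image_eq_image_iff (coe_subset.2 he) (coe_subset.2 he')).1 h)
    have hEim : ({e ∈ (range t).powersetCard 3 | e.image f ∈ E}).image (image f) = E := by
      ext e
      simp only [mem_image, mem_filter, mem_powersetCard]
      constructor
      · rintro ⟨e', ⟨-, h⟩, rfl⟩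
        exact h
      · intro he
        obtain ⟨hs, hc⟩ := mem_powersetCard.1 (hE he)
        rw [← himg] at hs
        obtain ⟨e', hs', rfl⟩ := subset_image_iff.1 hs
        have hs' : e' ⊆ range t := by exact_mod_cast hs'
        refine ⟨e', ⟨⟨hs', ?_⟩, he⟩, rfl⟩
        rwa [card_image_of_injOn (hinj.mono (coe_subset.2 hs'))] at hc
    refine ⟨by rw [← card_image_of_injOn hI, hEim], ?_⟩
    conv_rhs => rw [← hEim]
    rw [sum_image hI]
    refine sum_congr rfl fun e he => ?_
    have he := (mem_powersetCard.1 (mem_filter.1 he).1).1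
    rw [prod_image (hinj.mono (coe_subset.2 he))]

/-! ### Lower bounds for Lagrangians of colex graphs. -/

/-- The complete `3`-graph on `n + 2` vertices without the last `p` of the triples that contain
the last two vertices. -/
def brokenClique (n p : ℕ) : Finset (Finset ℕ) :=
  (range (n + 2)).powersetCard 3 \ (Ico (n - p) n).image fun i => {i, n, n + 1}

theorem injOn_insert_pair (n p : ℕ) :
    Set.InjOn (fun i : ℕ => ({i, n, n + 1} : Finset ℕ)) (Ico (n - p) n) := by
  intro i hi j hj h
  simp only [coe_Ico, Set.mem_Ico] at hi hj
  have : i ∈ ({j, n, n + 1} : Finset ℕ) := by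
    have h' : ({i, n, n + 1} : Finset ℕ) = {j, n, n + 1} := h
    exact h' ▸ mem_insert_self _ _
  simp only [mem_insert, mem_singleton] at this
  omega

theorem image_insert_pair_subset (n p : ℕ) :
    ((Ico (n - p) n).image fun i : ℕ => ({i, n, n + 1} : Finset ℕ)) ⊆
      (range (n + 2)).powersetCard 3 := by
  intro e he
  obtain ⟨i, hi, rfl⟩ := mem_image.1 he
  have := mem_Ico.1 hi
  refine mem_powersetCard.2 ⟨fun j hj => ?_, ?_⟩
  · simp only [mem_insert, mem_singleton] at hj
    rw [mem_range]; omega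
  · rw [card_insert_of_notMem (by simp; omega), card_insert_of_notMem (by simp), card_singleton]

theorem card_brokenClique_add {n p : ℕ} (hp : p ≤ n) :
    #(brokenClique n p) + p = (n + 2).choose 3 := by
  have h := card_sdiff_add_card_eq_card (image_insert_pair_subset n p)
  rwa [card_image_of_injOn (injOn_insert_pair n p), Nat.card_Ico, card_powersetCard, card_range,
    Nat.sub_sub_self hp] at h

/-- The removed triples are colex-last: a triple of `range (n + 2)` above a removed `{i, n, n + 1}`
must contain `n` and `n + 1`, and its third entry is at least `i`. -/
theorem isInitSeg_brokenClique (n p : ℕ) : Colex.IsInitSeg (brokenClique n p) 3 := by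
  refine ⟨fun A hA => (mem_powersetCard.1 (mem_sdiff.1 (mem_coe.1 hA)).1).2,
    fun A B hA hB => ?_⟩
  obtain ⟨hA, hA'⟩ := mem_sdiff.1 hA
  obtain ⟨hAs, hAc⟩ := mem_powersetCard.1 hA
  have hBs : B ⊆ range (n + 2) := fun b hb =>
    mem_range.2 (Colex.forall_lt_mono hB.1.le (fun a ha => mem_range.1 (hAs ha)) b hb)
  refine mem_sdiff.2 ⟨mem_powersetCard.2 ⟨hBs, hB.2⟩, fun hBi => hA' ?_⟩
  obtain ⟨i, hi, rfl⟩ := mem_image.1 hBi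
  obtain ⟨hne, hlt⟩ := Colex.toColex_lt_toColex.1 hB.1
  have hi := mem_Ico.1 hi
  have h1 : n + 1 ∈ A := by
    by_contra h
    obtain ⟨b, hb, hb', hle⟩ := hlt (a := n + 1) (by simp) h
    have := mem_range.1 (hAs hb)
    have : b = n + 1 := by omega
    exact h (this ▸ hb)
  have h2 : n ∈ A := by
    by_contra h
    obtain ⟨b, hb, hb', hle⟩ := hlt (a := n) (by simp) h
    have := mem_range.1 (hAs hb)
    have : b = n + 1 ∨ b = n := by omega
    rcases this with rfl | rfl
    · simp at hb'
    · exact h hb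
  obtain ⟨j, hj⟩ : ∃ j, (A.erase (n + 1)).erase n = {j} := by
    rw [← card_eq_one, card_erase_of_mem (mem_erase.2 ⟨by omega, h2⟩), card_erase_of_mem h1, hAc]
  have hjA : j ∈ (A.erase (n + 1)).erase n := hj ▸ mem_singleton_self j
  simp only [mem_erase] at hjA
  have hAeq : A = {j, n, n + 1} := by
    rw [← insert_erase h1, ← insert_erase (mem_erase.2 ⟨(by omega : n ≠ n + 1), h2⟩), hj]
    ext k; simp; tauto
  have hjn := mem_range.1 (hAs hjA.2.2)
  refine mem_image.2 ⟨j, mem_Ico.2 ⟨?_, by omega⟩, hAeq.symm⟩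
  by_contra! hlt'
  obtain ⟨b, hb, hb', hle⟩ := hlt (a := i) (by simp) (by rw [hAeq]; simp; omega)
  rw [hAeq] at hb
  simp only [mem_insert, mem_singleton] at hb hb'
  omega

theorem brokenClique_subset_colexFirst {n p M : ℕ} (hp : p ≤ n) (hM : (n + 2).choose 3 ≤ M + p) :
    brokenClique n p ⊆ colexFirst 3 M := by
  have hc := card_brokenClique_add hp
  rcases (isInitSeg_brokenClique n p).total (isInitSeg_colexFirst 3 M) with h' | h'
  · exact h'
  · rw [eq_of_subset_of_card_le h' (by rw [card_colexFirst (by norm_num)]; omega)]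

theorem clique_subset_colexFirst {k M : ℕ} (hM : k.choose 3 ≤ M) :
    (range k).powersetCard 3 ⊆ colexFirst 3 M := by
  rcases lt_or_ge k 2 with hk | hk
  · rw [powersetCard_eq_empty.2 (by rw [card_range]; omega)]
    exact empty_subset _
  · obtain ⟨n, rfl⟩ := Nat.exists_eq_add_of_le' hk
    have h := brokenClique_subset_colexFirst (p := 0) (n := n) (Nat.zero_le _) hM
    simpa [brokenClique] using h

/-- The covering hypothesis `hc` is there because the vertices of `colexGraph` are only those lying
in an edge, and a legal weighting vanishes elsewhere. -/
theorem sum_prod_le_lagrangian_colexGraph {M : ℕ} {A : Finset (Finset ℕ)}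
    (hA : A ⊆ colexFirst 3 M) {t : ℕ} {x : ℕ → ℝ} (h0 : ∀ i, 0 ≤ x i) (hx : ∀ i, t ≤ i → x i = 0)
    (h1 : ∑ i ∈ range t, x i = 1) (hc : ∀ i < t, ∃ e ∈ A, i ∈ e) :
    ∑ e ∈ A, ∏ i ∈ e, x i ≤ (colexGraph 3 M).lagrangian := by
  have hsub : range t ⊆ (colexGraph 3 M).verts := fun i hi => by
    obtain ⟨e, he, hie⟩ := hc i (mem_range.1 hi)
    exact mem_biUnion.2 ⟨e, hA he, hie⟩
  have hlegal : (colexGraph 3 M).IsLegal x := by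
    refine ⟨fun i _ => h0 i, fun i hi => hx i ?_, ?_⟩
    · by_contra! h
      exact hi (hsub (mem_range.2 h))
    · rw [← h1]
      exact (sum_subset hsub fun i _ hi => hx i (by simpa using hi)).symm
  have hne : (colexGraph 3 M).verts.Nonempty := by
    by_contra h
    rw [not_nonempty_iff_eq_empty] at h
    have := hlegal.2.2
    rw [h, sum_empty] at this
    exact zero_ne_one this
  refine le_trans (sum_le_sum_of_subset_of_nonneg hA fun e _ _ => prod_nonneg fun i _ => h0 i) ?_
  exact ((colexGraph 3 M).isGreatest_lagrangian hne).2 ⟨x, hlegal, rfl⟩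

/-- Vertex weights that are constant on `{0, …, n - 1}`. -/
def stepWeight (n : ℕ) (ρ α β : ℝ) (i : ℕ) : ℝ :=
  if i < n then ρ else if i = n then α else if i = n + 1 then β else 0

theorem sum_range_stepWeight (n : ℕ) (ρ α β : ℝ) (f : ℝ → ℝ) :
    ∑ i ∈ range (n + 2), f (stepWeight n ρ α β i) = n * f ρ + f α + f β := by
  rw [sum_range_succ, sum_range_succ, sum_congr rfl (g := fun _ => f ρ) fun i hi => by
    rw [stepWeight, if_pos (mem_range.1 hi)]]
  simp [stepWeight]

theorem stepWeight_nonneg {n : ℕ} {ρ α β : ℝ} (hρ : 0 ≤ ρ) (hα : 0 ≤ α) (hβ : 0 ≤ β) (i : ℕ) :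
    0 ≤ stepWeight n ρ α β i := by
  unfold stepWeight; split_ifs <;> first | assumption | exact le_rfl

theorem brokenWeight_le_lagrangian {n p M : ℕ} (hn : 2 ≤ n) (hp : p ≤ n)
    (hM : (n + 2).choose 3 ≤ M + p) {s : ℝ} (hs : 0 ≤ s) (hs1 : s ≤ 1) :
    cliqueWeight n s + s ^ 2 / 4 * (1 - s) * (1 - p / n) ≤ (colexGraph 3 M).lagrangian := by
  have hn0 : (n : ℝ) ≠ 0 := by positivity
  set ρ : ℝ := (1 - s) / n with hρ
  have hρ0 : 0 ≤ ρ := div_nonneg (by linarith) (by positivity)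
  have hnρ : n * ρ = 1 - s := by rw [hρ]; field_simp
  let y := stepWeight n ρ (s / 2) (s / 2)
  have hy : ∀ f : ℝ → ℝ, ∑ i ∈ range (n + 2), f (y i) = n * f ρ + f (s / 2) + f (s / 2) :=
    sum_range_stepWeight n ρ (s / 2) (s / 2)
  have h1 : ∑ i ∈ range (n + 2), y i = 1 := by
    rw [hy fun z => z, hnρ]; ring
  have h := sum_prod_le_lagrangian_colexGraph (brokenClique_subset_colexFirst hp hM) (t := n + 2)
    (x := y) (stepWeight_nonneg hρ0 (by linarith) (by linarith)) (fun i hi => by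
      simp only [y, stepWeight]
      rw [if_neg (by omega), if_neg (by omega), if_neg (by omega)]) h1 ?_
  · refine le_trans (le_of_eq ?_) h
    rw [brokenClique, sum_sdiff_eq_sub (image_insert_pair_subset n p),
      sum_powersetCard_three_prod, h1, hy fun z => z ^ 2, hy fun z => z ^ 3,
      sum_image (injOn_insert_pair n p), sum_congr rfl (g := fun _ => ρ * (s / 2 * (s / 2)))]
    · rw [sum_const, Nat.card_Ico, Nat.sub_sub_self hp, nsmul_eq_mul, cliqueWeight, ← hρ]
      have : (p : ℝ) * (ρ * (s / 2 * (s / 2))) = s ^ 2 / 4 * (1 - s) * (p / n) := by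
        rw [hρ]; field_simp; ring
      rw [this]
      ring
    · intro i hi
      have hi := mem_Ico.1 hi
      rw [prod_insert (by simp; omega), prod_insert (by simp), prod_singleton]
      simp [y, stepWeight, hi.2]
  -- Removed triples contain both `n` and `n + 1`, so suitable triples through `0` and `1` survive
  -- and cover every vertex.
  · have hmem : ∀ e ∈ (range (n + 2)).powersetCard 3, (n ∉ e ∨ n + 1 ∉ e) → e ∈ brokenClique n p := by
      intro e he h
      refine mem_sdiff.2 ⟨he, fun hi => ?_⟩
      obtain ⟨i, -, rfl⟩ := mem_image.1 hi
      simp at h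
    intro i hi
    rcases lt_or_ge i 2 with h2 | h2
    · refine ⟨{0, 1, n + 1}, hmem _ (mem_powersetCard.2 ⟨fun j hj => ?_, ?_⟩) ?_, ?_⟩
      · simp only [mem_insert, mem_singleton] at hj
        rw [mem_range]; omega
      · rw [card_insert_of_notMem (by simp), card_insert_of_notMem (by simp; omega),
          card_singleton]
      · left; simp; omega
      · simp; omega
    · refine ⟨{0, 1, i}, hmem _ (mem_powersetCard.2 ⟨fun j hj => ?_, ?_⟩) ?_, by simp⟩
      · simp only [mem_insert, mem_singleton] at hj
        rw [mem_range]; omega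
      · rw [card_insert_of_notMem (by simp; omega), card_insert_of_notMem (by simp; omega),
          card_singleton]
      · simp; omega

theorem clique_sum_le_lagrangian {t M : ℕ} (ht : 3 ≤ t) (hM : t.choose 3 ≤ M) {x : ℕ → ℝ}
    (h0 : ∀ i < t, 0 ≤ x i) (h1 : ∑ i ∈ range t, x i = 1) :
    ∑ e ∈ (range t).powersetCard 3, ∏ i ∈ e, x i ≤ (colexGraph 3 M).lagrangian := by
  have hz : ∀ i ∈ range t, x i = if i < t then x i else 0 := fun i hi => by
    rw [if_pos (mem_range.1 hi)]
  rw [sum_congr rfl hz] at h1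
  rw [sum_congr rfl fun e he => prod_congr rfl fun i hi => hz i ((mem_powersetCard.1 he).1 hi)]
  refine sum_prod_le_lagrangian_colexGraph (clique_subset_colexFirst hM) (fun i => ?_)
    (fun i hi => if_neg (by omega)) h1 fun i hi => ?_
  · split_ifs with h
    · exact h0 i h
    · exact le_rfl
  · obtain ⟨e, hie, het, hc⟩ := exists_subsuperset_card_eq (s := {i}) (t := range t) (n := 3)
      (by simpa using hi) (by simp) (by simpa using ht)
    exact ⟨e, mem_powersetCard.2 ⟨het, hc⟩, hie (mem_singleton_self i)⟩

/-- Only `n + 1` vertices carry weight, so the smaller clique suffices. In `stepWeight` the last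
vertex gets `0`. -/
theorem cliqueWeight_le_lagrangian {n M : ℕ} (hn : 2 ≤ n) (hM : (n + 1).choose 3 ≤ M) {s : ℝ}
    (hs : 0 ≤ s) (hs1 : s ≤ 1) : cliqueWeight n s ≤ (colexGraph 3 M).lagrangian := by
  have hn0 : (n : ℝ) ≠ 0 := by positivity
  set ρ : ℝ := (1 - s) / n with hρ
  have hρ0 : 0 ≤ ρ := div_nonneg (by linarith) (by positivity)
  have hnρ : n * ρ = 1 - s := by rw [hρ]; field_simp
  have hy : ∀ f : ℝ → ℝ, ∑ i ∈ range (n + 1), f (stepWeight n ρ s 0 i) = n * f ρ + f s := by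
    intro f
    have := sum_range_stepWeight n ρ s 0 f
    rw [sum_range_succ] at this
    simp [stepWeight] at this ⊢
    linarith
  have h1 : ∑ i ∈ range (n + 1), stepWeight n ρ s 0 i = 1 := by
    rw [hy fun z => z, hnρ]; ring
  refine le_trans (le_of_eq ?_) (clique_sum_le_lagrangian (by omega) hM
    (fun i _ => stepWeight_nonneg hρ0 hs le_rfl i) h1)
  rw [sum_powersetCard_three_prod, h1, hy fun z => z ^ 2, hy fun z => z ^ 3, cliqueWeight, ← hρ]
  ring

/-! ### First-order optimality conditions. -/

namespace RGraph

/-- The partial derivative of the weight polynomial. -/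
noncomputable def partialWeight (E : Finset (Finset ℕ)) (x : ℕ → ℝ) (i : ℕ) : ℝ :=
  ∑ e ∈ E with i ∈ e, ∏ j ∈ e.erase i, x j

/-- The Lagrange condition at a vertex of positive weight. -/
theorem three_mul_le_partialWeight {G : RGraph ℕ 3} {x : ℕ → ℝ} (hx : G.IsLegal x)
    (hmax : ∀ y, G.IsLegal y → G.weight y ≤ G.weight x) {i : ℕ} (hi : 0 < x i) :
    3 * G.weight x ≤ partialWeight G.edges x i := by
  set w := G.weight x with hw
  set d := partialWeight G.edges x i with hd
  obtain ⟨h0, hout, h1⟩ := hx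
  have hiV : i ∈ G.verts := by
    by_contra h
    exact hi.ne' (hout i h)
  have hi1 : x i ≤ 1 := h1 ▸ single_le_sum h0 hiV
  have key : ∀ σ : ℝ, 0 < σ → σ ≤ x i → (3 + 3 * σ + σ ^ 2) * w ≤ (1 + σ) ^ 2 * d := by
    intro σ hσ hσi
    -- Weight `σ` is taken from `i` after scaling everything by `1 + σ`; comparing weights to first
    -- order in `σ` gives the condition.
    let y : ℕ → ℝ := fun j => (1 + σ) * x j - if j = i then σ else 0
    have hyi : y i = (1 + σ) * x i - σ := by simp [y]
    have hyj : ∀ j, j ≠ i → y j = (1 + σ) * x j := fun j hj => by simp [y, hj]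
    have hy : G.IsLegal y := by
      refine ⟨fun j hj => ?_, fun j hj => ?_, ?_⟩
      · by_cases h : j = i
        · rw [h, hyi]; nlinarith
        · rw [hyj j h]; exact mul_nonneg (by linarith) (h0 j hj)
      · rw [hyj j (fun h => hj (h ▸ hiV)), hout j hj, mul_zero]
      · simp only [y]
        rw [sum_sub_distrib, ← mul_sum, h1, sum_ite_eq', if_pos hiV]
        ring
    have hwy : G.weight y = (1 + σ) ^ 3 * w - σ * (1 + σ) ^ 2 * d := by
      rw [hw, hd, weight, weight, partialWeight, mul_sum, mul_sum, sum_filter, ← sum_sub_distrib]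
      refine sum_congr rfl fun e he => ?_
      have hc : #e = 3 := (mem_powersetCard.1 (G.edges_subset he)).2
      split_ifs with hie
      · rw [← mul_prod_erase e _ hie, ← mul_prod_erase e x hie, hyi,
          prod_congr rfl fun j hj => hyj j (ne_of_mem_erase hj), prod_mul_distrib, prod_const,
          card_erase_of_mem hie, hc]
        ring
      · rw [prod_congr rfl fun j hj => hyj j (fun h => hie (h ▸ hj)), prod_mul_distrib, prod_const,
          hc]
        ring
    have := hmax y hy
    rw [hwy] at this
    have h2 : σ * ((3 + 3 * σ + σ ^ 2) * w) ≤ σ * ((1 + σ) ^ 2 * d) := by linarith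
    exact le_of_mul_le_mul_left h2 hσ
  have hw0 : 0 ≤ w := sum_nonneg fun e he => prod_nonneg fun j hj =>
    h0 j ((mem_powersetCard.1 (G.edges_subset he)).1 hj)
  by_contra! hlt
  have hd0 : 0 ≤ d := by
    have := key _ hi le_rfl
    by_contra! h
    nlinarith [mul_nonneg (by nlinarith : (0:ℝ) ≤ 3 + 3 * x i + x i ^ 2) hw0,
      mul_pos_of_neg_of_neg h (by nlinarith : -(1 + x i) ^ 2 < 0)]
  -- Small enough that the higher-order terms, at most `3 * σ * d` since `σ ≤ 1`, stay below the gap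
  -- `3 * w - d`.
  set σ := min (x i) ((3 * w - d) / (3 * d + 1)) with hσ
  have hε : 0 < (3 * w - d) / (3 * d + 1) := div_pos (by linarith) (by linarith)
  have hσ0 : 0 < σ := lt_min hi hε
  have hσ1 : σ * (3 * d + 1) ≤ 3 * w - d := by
    rw [← le_div_iff₀ (by linarith)]
    exact min_le_right _ _
  have hσi : σ ≤ x i := min_le_left _ _
  have := key σ hσ0 hσi
  nlinarith [mul_nonneg hσ0.le hw0, mul_nonneg (mul_nonneg hσ0.le hσ0.le) hw0,
    mul_nonneg hσ0.le hd0, mul_nonneg (mul_nonneg hσ0.le hd0) (by linarith : 0 ≤ 1 - σ)]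

end RGraph

/-! ### Size of the support of an optimal weighting. -/

theorem partialWeight_le {S : Finset ℕ} {E : Finset (Finset ℕ)} (hE : E ⊆ S.powersetCard 3)
    {x : ℕ → ℝ} (h0 : ∀ i ∈ S, 0 ≤ x i) (h1 : ∑ i ∈ S, x i = 1) {i : ℕ} (hi : i ∈ S) :
    RGraph.partialWeight E x i ≤ (1 - 2 * x i + 2 * x i ^ 2 - ∑ j ∈ S, x j ^ 2) / 2 := by
  have hmaps : ∀ e ∈ {e ∈ E | i ∈ e}, e.erase i ∈ (S.erase i).powersetCard 2 := by
    intro e he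
    obtain ⟨he, hie⟩ := mem_filter.1 he
    obtain ⟨hs, hc⟩ := mem_powersetCard.1 (hE he)
    exact mem_powersetCard.2 ⟨erase_subset_erase _ hs, by rw [card_erase_of_mem hie, hc]⟩
  have hinj : Set.InjOn (fun e : Finset ℕ => e.erase i) ({e ∈ E | i ∈ e} : Finset (Finset ℕ)) := by
    simp only [Set.InjOn, mem_coe]
    intro e he f hf h
    have he := (mem_filter.1 he).2
    have hf := (mem_filter.1 hf).2
    rw [← insert_erase he, ← insert_erase hf]
    exact congrArg _ h
  have h : RGraph.partialWeight E x i ≤ ∑ e ∈ (S.erase i).powersetCard 2, ∏ j ∈ e, x j := by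
    rw [RGraph.partialWeight, ← sum_image (f := fun e => ∏ j ∈ e, x j) hinj]
    refine sum_le_sum_of_subset_of_nonneg (fun e he => ?_) fun e he _ => prod_nonneg fun j hj =>
      h0 j (mem_of_mem_erase ((mem_powersetCard.1 he).1 hj))
    obtain ⟨f, hf, rfl⟩ := mem_image.1 he
    exact hmaps f hf
  refine h.trans (le_of_eq ?_)
  rw [sum_powersetCard_two_prod]
  have e1 := add_sum_erase S x hi
  have e2 := add_sum_erase S (fun j => x j ^ 2) hi
  have e3 : ∑ j ∈ S.erase i, x j = 1 - x i := by linarith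
  have e4 : ∑ j ∈ S.erase i, x j ^ 2 = ∑ j ∈ S, x j ^ 2 - x i ^ 2 := by linarith
  rw [e3, e4]
  ring

theorem partialWeight_le_card_mul {S : Finset ℕ} {E : Finset (Finset ℕ)}
    (hE : E ⊆ S.powersetCard 3) {x : ℕ → ℝ} (h0 : ∀ i ∈ S, 0 ≤ x i) {X : ℝ}
    (hX : ∀ i ∈ S, x i ≤ X) (i : ℕ) :
    RGraph.partialWeight E x i ≤ #{e ∈ E | i ∈ e} * X ^ 2 := by
  rw [RGraph.partialWeight, ← nsmul_eq_mul]
  refine sum_le_card_nsmul _ _ _ fun e he => ?_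
  obtain ⟨he, hie⟩ := mem_filter.1 he
  obtain ⟨hs, hc⟩ := mem_powersetCard.1 (hE he)
  have : #(e.erase i) = 2 := by rw [card_erase_of_mem hie, hc]
  rw [← this, ← prod_const]
  exact prod_le_prod (fun j hj => h0 j (hs (mem_of_mem_erase hj))) fun j hj =>
    hX j (hs (mem_of_mem_erase hj))

/-- Cauchy–Schwarz over the edges. With few edges and near-optimal weight it forces `∑ x i ^ 2` to
be large. -/
theorem sq_sum_prod_le {S : Finset ℕ} {E : Finset (Finset ℕ)} (hE : E ⊆ S.powersetCard 3)
    (x : ℕ → ℝ) : (∑ e ∈ E, ∏ i ∈ e, x i) ^ 2 ≤ #E * ((∑ i ∈ S, x i ^ 2) ^ 3 / 6) := by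
  refine (sq_sum_le_card_mul_sum_sq (s := E) (f := fun e => ∏ i ∈ e, x i)).trans ?_
  refine mul_le_mul_of_nonneg_left ?_ (Nat.cast_nonneg _)
  simp only [← prod_pow]
  exact (sum_le_sum_of_subset_of_nonneg hE fun e _ _ => prod_nonneg fun i _ => sq_nonneg _).trans
    (sum_powersetCard_three_prod_le S (fun i => x i ^ 2) fun i _ => sq_nonneg _)

theorem sum_card_mem {S : Finset ℕ} {E : Finset (Finset ℕ)} (hE : E ⊆ S.powersetCard 3) :
    ∑ i ∈ S, #{e ∈ E | i ∈ e} = 3 * #E := by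
  simp only [card_eq_sum_ones, sum_filter]
  rw [sum_comm, mul_sum]
  refine sum_congr rfl fun e he => ?_
  obtain ⟨hs, hc⟩ := mem_powersetCard.1 (hE he)
  rw [← sum_filter, filter_mem_eq_inter, inter_eq_right.2 hs, ← card_eq_sum_ones, hc, mul_one]

theorem card_powersetCard_mem {S : Finset ℕ} {i : ℕ} (hi : i ∈ S) :
    #{e ∈ S.powersetCard 3 | i ∈ e} = (#S - 1).choose 2 := by
  have h := powersetCard_succ_insert (notMem_erase i S) 2
  rw [insert_erase hi] at h
  have hn : ∀ e ∈ (S.erase i).powersetCard 2, i ∉ e := fun e he h =>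
    notMem_erase i S ((mem_powersetCard.1 he).1 h)
  have e : {e ∈ S.powersetCard 3 | i ∈ e} = ((S.erase i).powersetCard 2).image (insert i) := by
    rw [h, filter_union, filter_false_of_mem fun e he h' =>
      notMem_erase i S ((mem_powersetCard.1 he).1 h'), empty_union, filter_true_of_mem]
    intro e he
    obtain ⟨f, -, rfl⟩ := mem_image.1 he
    exact mem_insert_self _ _
  rw [e, card_image_of_injOn, card_powersetCard, card_erase_of_mem hi]
  intro e he f hf h
  rw [← erase_insert (hn e he), ← erase_insert (hn f hf), h]

theorem sum_sq_lower_bound {T w P M : ℝ} (hT : 7000 ≤ T) (hP0 : 0 ≤ P)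
    (hM : M ≤ T * (T - 1) * (T - 2) / 6) (hwM : w ^ 2 ≤ M * (P ^ 3 / 6))
    (hw : (T - 2) * (T - 3) / (T - 1) ^ 2 ≤ 6 * w) : (T - 3) / T ^ 2 ≤ P := by
  by_contra! hlt
  have k1 : w ^ 2 ≤ T * (T - 1) * (T - 2) / 6 * (P ^ 3 / 6) :=
    hwM.trans (mul_le_mul_of_nonneg_right hM (by positivity))
  have k2 : P ^ 3 < ((T - 3) / T ^ 2) ^ 3 := pow_lt_pow_left₀ hlt hP0 (by norm_num)
  have k3 : ((T - 2) * (T - 3) / (T - 1) ^ 2) ^ 2 ≤ (6 * w) ^ 2 :=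
    pow_le_pow_left₀ (div_nonneg (mul_nonneg (by linarith) (by linarith)) (sq_nonneg _)) hw 2
  have k4 : 0 < T * (T - 1) * (T - 2) :=
    mul_pos (mul_pos (by linarith) (by linarith)) (by linarith)
  have k5 : ((T - 2) * (T - 3) / (T - 1) ^ 2) ^ 2 < T * (T - 1) * (T - 2) * ((T - 3) / T ^ 2) ^ 3 := by
    nlinarith [mul_lt_mul_of_pos_left k2 k4]
  rw [div_pow, div_pow, ← mul_div_assoc, div_lt_div_iff₀ (by
    have : 0 < T - 1 := by linarith
    positivity) (by positivity)] at k5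
  have c : 0 < T * (T - 2) * (T - 3) ^ 2 :=
    mul_pos (mul_pos (by linarith) (by linarith)) (pow_pos (by linarith) 2)
  have k6 : (T - 2) * T ^ 5 < (T - 3) * (T - 1) ^ 5 := by
    refine lt_of_mul_lt_mul_left ?_ c.le
    calc T * (T - 2) * (T - 3) ^ 2 * ((T - 2) * T ^ 5)
        = ((T - 2) * (T - 3)) ^ 2 * (T ^ 2) ^ 3 := by ring
      _ < _ := k5
      _ = _ := by ring
  have k7 : (T - 1) ^ 5 ≤ T ^ 5 := pow_le_pow_left₀ (by linarith) (by linarith) 5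
  nlinarith [mul_le_mul_of_nonneg_left k7 (by linarith : 0 ≤ T - 3), pow_pos (by linarith : 0 < T) 5]

theorem one_sub_three_mul_inv_le {T : ℝ} (hT : 7000 ≤ T) :
    1 - 3 * (1 / T) - (1 / T) ^ 2 ≤ (T - 2) * (T - 3) / (T - 1) ^ 2 := by
  rw [le_div_iff₀ (by nlinarith)]
  have : (1 - 3 * (1 / T) - (1 / T) ^ 2) * (T - 1) ^ 2 =
      (T ^ 2 - 3 * T - 1) * (T - 1) ^ 2 / T ^ 2 := by
    have : T ≠ 0 := by linarith
    field_simp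
  rw [this, div_le_iff₀ (by nlinarith)]
  nlinarith

/-- Inserting `z ^ 2 ≤ P` into `k1` gives the crude bound `z ≤ 3ε`. Then `2z - 2z² ≤ 2ε + 4ε²`
yields `z ≤ ε + 2ε² + 9ε²`. -/
theorem max_weight_bound {ε w P z : ℝ} (hε0 : 0 < ε) (hε1 : ε ≤ 1 / 7000)
    (hPε : ε - 3 * ε ^ 2 ≤ P) (hwε : 1 - 3 * ε - ε ^ 2 ≤ 6 * w)
    (k1 : 6 * w ≤ 1 - 2 * z + 2 * z ^ 2 - P) (k2 : 0 ≤ z) (k3 : z ≤ 1) (k4 : z ^ 2 ≤ P) :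
    z ≤ ε + 11 * ε ^ 2 := by
  have k5 : z ≤ 1 / 2 := by nlinarith
  have k6 : z ≤ 3 * ε := by nlinarith
  nlinarith

theorem degree_lower_bound {T ε w D : ℝ} (hTε : T * ε = 1) (hε0 : 0 < ε) (hwε : 1 - 3 * ε - ε ^ 2 ≤ 6 * w)
    (hD : 3 * w ≤ D * (ε + 11 * ε ^ 2) ^ 2) : T ^ 2 / 2 - 13 * T ≤ D := by
  have k2 : (1 - 3 * ε - ε ^ 2) / 2 ≤ D * (ε + 11 * ε ^ 2) ^ 2 := by linarith
  have k3 : (1 - 3 * ε - ε ^ 2) / 2 * T ^ 2 ≤ D * (1 + 11 * ε) ^ 2 := by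
    calc (1 - 3 * ε - ε ^ 2) / 2 * T ^ 2 ≤ D * (ε + 11 * ε ^ 2) ^ 2 * T ^ 2 :=
          mul_le_mul_of_nonneg_right k2 (sq_nonneg _)
      _ = D * (1 + 11 * ε) ^ 2 * (T * ε) ^ 2 := by ring
      _ = _ := by rw [hTε]; ring
  have k4 : (1 - 26 * ε) * (1 + 11 * ε) ^ 2 ≤ 1 - 3 * ε - ε ^ 2 := by nlinarith
  have k5 : (1 - 26 * ε) / 2 * T ^ 2 ≤ D := by
    refine le_of_mul_le_mul_right (le_trans ?_ k3) (by positivity : 0 < (1 + 11 * ε) ^ 2)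
    nlinarith [mul_le_mul_of_nonneg_right k4 (sq_nonneg T)]
  have k6 : (1 - 26 * ε) / 2 * T ^ 2 = T ^ 2 / 2 - 13 * T * (T * ε) := by ring
  rw [k6, hTε] at k5
  linarith

set_option maxHeartbeats 1000000 in
/-- Near-optimal weightings that satisfy the Lagrange conditions live on at most `t` vertices. -/
theorem card_support_le {t : ℕ} (ht : 7000 ≤ t) {S : Finset ℕ} {E : Finset (Finset ℕ)}
    (hE : E ⊆ S.powersetCard 3) (hm : #E ≤ t.choose 3) {x : ℕ → ℝ} (hpos : ∀ i ∈ S, 0 < x i)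
    (h1 : ∑ i ∈ S, x i = 1)
    (hw : ((t : ℝ) - 2) * (t - 3) / (t - 1) ^ 2 ≤ 6 * ∑ e ∈ E, ∏ i ∈ e, x i)
    (hd : ∀ i ∈ S, 3 * ∑ e ∈ E, ∏ i ∈ e, x i ≤ RGraph.partialWeight E x i) : #S ≤ t := by
  set w := ∑ e ∈ E, ∏ i ∈ e, x i with hwdef
  set P := ∑ i ∈ S, x i ^ 2 with hP
  have h0 : ∀ i ∈ S, 0 ≤ x i := fun i hi => (hpos i hi).le
  obtain ⟨T, hTdef⟩ : ∃ T : ℝ, T = t := ⟨_, rfl⟩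
  have hT : (7000 : ℝ) ≤ T := by rw [hTdef]; exact_mod_cast ht
  rw [← hTdef] at hw
  have hm' : (#E : ℝ) ≤ T * (T - 1) * (T - 2) / 6 := by
    rw [hTdef, ← cast_choose_three]; exact_mod_cast hm
  have hP0 : 0 ≤ P := sum_nonneg fun i _ => sq_nonneg _
  have hPlow : (T - 3) / T ^ 2 ≤ P := sum_sq_lower_bound hT hP0 hm' (sq_sum_prod_le hE x) hw
  obtain ⟨ε, hε⟩ : ∃ ε : ℝ, ε = 1 / T := ⟨_, rfl⟩
  have hTε : T * ε = 1 := by rw [hε]; field_simp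
  have hε0 : 0 < ε := by rw [hε]; positivity
  have hε1 : ε ≤ 1 / 7000 := by rw [hε]; exact one_div_le_one_div_of_le (by norm_num) hT
  have hPε : ε - 3 * ε ^ 2 ≤ P := by
    refine le_trans (le_of_eq ?_) hPlow
    rw [hε]; field_simp
  have hwε : 1 - 3 * ε - ε ^ 2 ≤ 6 * w := by
    rw [hε]; exact (one_sub_three_mul_inv_le hT).trans hw
  have hbd : ∀ i ∈ S, 6 * w ≤ 1 - 2 * x i + 2 * x i ^ 2 - P := fun i hi => by
    have := (hd i hi).trans (partialWeight_le hE h0 h1 hi)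
    linarith
  have hX : ∀ i ∈ S, x i ≤ ε + 11 * ε ^ 2 := by
    intro i hi
    exact max_weight_bound hε0 hε1 hPε hwε (hbd i hi) (h0 i hi) (h1 ▸ single_le_sum h0 hi)
      (single_le_sum (f := fun i => x i ^ 2) (fun j _ => sq_nonneg _) hi)
  have hdeg : ∀ i ∈ S, T ^ 2 / 2 - 13 * T ≤ #{e ∈ E | i ∈ e} := by
    intro i hi
    exact degree_lower_bound hTε hε0 hwε
      ((hd i hi).trans (partialWeight_le_card_mul hE h0 hX i))
  obtain ⟨K, hK⟩ : ∃ K : ℝ, K = #S := ⟨_, rfl⟩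
  -- Double counting of incidences: every degree is at least `T² / 2 - 13T`, while there are at most
  -- about `T³ / 6` edges.
  have hKT : K ≤ T + 27 := by
    have k1 : K * (T ^ 2 / 2 - 13 * T) ≤ 3 * #E := by
      have k : ∑ i ∈ S, (#{e ∈ E | i ∈ e} : ℝ) = 3 * #E := by exact_mod_cast sum_card_mem hE
      rw [hK, ← nsmul_eq_mul, ← k]
      exact card_nsmul_le_sum _ _ _ hdeg
    have k2 : 7000 * T ≤ T * T := mul_le_mul_of_nonneg_right hT (by linarith)
    by_contra! h
    have k3 := mul_lt_mul_of_pos_right h (by linarith : 0 < T ^ 2 / 2 - 13 * T)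
    linarith
  by_contra! hkt
  have hKt : T + 1 ≤ K := by rw [hK, hTdef]; exact_mod_cast hkt
  -- A support of more than `t` vertices would leave at least `t.choose 2` non-edges. The
  -- contradiction is that there are only `O(t)`: at most 77 light vertices meet at most `40T` each,
  -- and a non-edge of heavy vertices weighs at least `(ε/2)³` out of a total of `O(ε²)`.
  set N := S.powersetCard 3 \ E with hN
  have hNcard : T * (T - 1) / 2 ≤ #N := by
    rw [hN, card_sdiff_of_subset hE, card_powersetCard, Nat.cast_sub (by
      rw [← card_powersetCard]; exact card_le_card hE), cast_choose_three, ← hK]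
    have k : (T + 1) * T * (T - 1) ≤ K * (K - 1) * (K - 2) :=
      mul_le_mul (mul_le_mul hKt (by linarith) (by linarith) (by linarith)) (by linarith)
        (by linarith) (mul_nonneg (by linarith) (by linarith))
    linarith
  have hNw : 6 * ∑ e ∈ N, ∏ i ∈ e, x i ≤ 13 * ε ^ 2 := by
    rw [hN, sum_sdiff_eq_sub hE, sum_powersetCard_three_prod, h1, ← hwdef, ← hP]
    have k : ∑ i ∈ S, x i ^ 3 ≤ (ε + 11 * ε ^ 2) * P := by
      rw [hP, mul_sum]
      refine sum_le_sum fun i hi => ?_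
      nlinarith [mul_le_mul_of_nonneg_right (hX i hi) (sq_nonneg (x i))]
    have c1 : ε ^ 2 * ε ≤ ε ^ 2 * (1 / 7000) := mul_le_mul_of_nonneg_left hε1 (sq_nonneg ε)
    have c2 : 0 ≤ 3 - 2 * ε - 22 * ε ^ 2 := by nlinarith
    have c3 := mul_le_mul_of_nonneg_right hPε c2
    have c4 : 0 ≤ ε ^ 4 := by positivity
    linarith only [hwε, k, c1, c3, c4, sq_nonneg ε]
  have hnondeg : ∀ i ∈ S, (#{e ∈ N | i ∈ e} : ℝ) ≤ 40 * T := by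
    intro i hi
    have k1 : #{e ∈ N | i ∈ e} + #{e ∈ E | i ∈ e} = (#S - 1).choose 2 := by
      rw [← card_powersetCard_mem hi, ← card_union_of_disjoint, ← filter_union, hN,
        sdiff_union_of_subset hE]
      exact disjoint_filter_filter sdiff_disjoint
    have k2 : (#{e ∈ N | i ∈ e} : ℝ) + #{e ∈ E | i ∈ e} = (K - 1) * (K - 1 - 1) / 2 := by
      rw [hK, ← Nat.cast_add, k1, Nat.cast_choose_two, Nat.cast_sub (by omega)]
      simp
    have := hdeg i hi
    nlinarith
  set A := {i ∈ S | x i < ε / 2} with hA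
  have hAcard : (#A : ℝ) ≤ 77 := by
    have k1 : ∑ i ∈ S, x i ≤ ∑ i ∈ S, ((ε + 11 * ε ^ 2) - if x i < ε / 2 then ε / 2 else 0) := by
      refine sum_le_sum fun i hi => ?_
      split_ifs with h
      · nlinarith
      · linarith [hX i hi]
    rw [h1, sum_sub_distrib, ← sum_filter, sum_const, sum_const, nsmul_eq_mul, nsmul_eq_mul, ← hK]
      at k1
    have k2 : K * (ε + 11 * ε ^ 2) ≤ (T + 27) * (ε + 11 * ε ^ 2) :=
      mul_le_mul_of_nonneg_right hKT (by positivity)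
    have k3 : (T + 27) * (ε + 11 * ε ^ 2) = T * ε + 11 * (T * ε) * ε + 27 * (ε + 11 * ε ^ 2) := by
      ring
    rw [k3, hTε] at k2
    by_contra! h
    nlinarith
  have hsplit : (#N : ℝ) ≤ ∑ i ∈ A, (#{e ∈ N | i ∈ e} : ℝ) + #{e ∈ N | ∀ i ∈ e, ε / 2 ≤ x i} := by
    rw [← Nat.cast_sum, ← Nat.cast_add]
    refine Nat.cast_le.2 ((card_le_card fun e he => ?_).trans ((card_union_le _ _).trans
      (Nat.add_le_add_right card_biUnion_le _)))
    rw [mem_union]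
    by_cases h : ∀ i ∈ e, ε / 2 ≤ x i
    · exact Or.inr (mem_filter.2 ⟨he, h⟩)
    · push Not at h
      obtain ⟨i, hi, hlt⟩ := h
      have hiS := (mem_powersetCard.1 (mem_sdiff.1 he).1).1 hi
      exact Or.inl (mem_biUnion.2 ⟨i, mem_filter.2 ⟨hiS, hlt⟩, mem_filter.2 ⟨he, hi⟩⟩)
  have hlow : ∑ i ∈ A, (#{e ∈ N | i ∈ e} : ℝ) ≤ 77 * (40 * T) := by
    refine (sum_le_card_nsmul A _ _ fun i hi => hnondeg i (mem_filter.1 hi).1).trans ?_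
    rw [nsmul_eq_mul]
    exact mul_le_mul_of_nonneg_right hAcard (by linarith)
  have hhigh : (#{e ∈ N | ∀ i ∈ e, ε / 2 ≤ x i} : ℝ) ≤ 18 * T := by
    have k1 : #{e ∈ N | ∀ i ∈ e, ε / 2 ≤ x i} * (ε / 2) ^ 3 ≤ ∑ e ∈ N, ∏ i ∈ e, x i := by
      rw [← nsmul_eq_mul]
      refine (card_nsmul_le_sum _ (fun e => ∏ i ∈ e, x i) _ fun e he => ?_).trans
        (sum_le_sum_of_subset_of_nonneg (filter_subset _ _) fun e he _ => prod_nonneg fun i hi =>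
          h0 i ((mem_powersetCard.1 (mem_sdiff.1 he).1).1 hi))
      obtain ⟨he, hh⟩ := mem_filter.1 he
      rw [← (mem_powersetCard.1 (mem_sdiff.1 he).1).2, ← prod_const]
      exact prod_le_prod (fun i _ => by positivity) hh
    set Q : ℝ := (#{e ∈ N | ∀ i ∈ e, ε / 2 ≤ x i} : ℝ)
    have k2 : Q * ε * ε ^ 2 ≤ 18 * ε ^ 2 := by nlinarith
    have k3 : Q * ε ≤ 18 := le_of_mul_le_mul_right k2 (by positivity)
    calc Q = Q * ε * T := by rw [mul_assoc, mul_comm ε, hTε, mul_one]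
      _ ≤ 18 * T := mul_le_mul_of_nonneg_right k3 (by linarith)
  -- `77 * 40 + 18 = 3098`, so `T * (T - 1) / 2 ≤ 3098 * T`, which fails for `T ≥ 7000`.
  nlinarith

/-! ### Reduction to sorted weights and comparison with colex graphs. -/

theorem RGraph.lagrangian_nonneg (G : RGraph ℕ 3) : 0 ≤ G.lagrangian := by
  refine Real.sSup_nonneg ?_
  rintro _ ⟨x, ⟨h0, -, -⟩, rfl⟩
  exact sum_nonneg fun e he => prod_nonneg fun j hj =>
    h0 j ((mem_powersetCard.1 (G.edges_subset he)).1 hj)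

/-- Restricting an optimal weighting to its support. -/
theorem RGraph.exists_optimal_support {H : RGraph ℕ 3} (hH : 0 < H.lagrangian) :
    ∃ (S : Finset ℕ) (E : Finset (Finset ℕ)) (x : ℕ → ℝ), E ⊆ S.powersetCard 3 ∧
      #E ≤ #H.edges ∧ (∀ i ∈ S, 0 < x i) ∧ ∑ i ∈ S, x i = 1 ∧
      ∑ e ∈ E, ∏ i ∈ e, x i = H.lagrangian ∧
      (∀ i ∈ S, 3 * ∑ e ∈ E, ∏ i ∈ e, x i ≤ RGraph.partialWeight E x i) ∧ #S ≤ 3 * #H.edges := by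
  have hne : H.verts.Nonempty := by
    by_contra h
    rw [not_nonempty_iff_eq_empty] at h
    have : H.lagrangian ≤ 0 := by
      refine Real.sSup_le ?_ le_rfl
      rintro _ ⟨x, ⟨-, -, h1⟩, rfl⟩
      rw [h, sum_empty] at h1
      exact absurd h1 zero_ne_one
    linarith
  obtain ⟨⟨x, hx, hxw⟩, hmax⟩ := H.isGreatest_lagrangian hne
  have hkkt : ∀ i, 0 < x i → 3 * H.weight x ≤ partialWeight H.edges x i := fun i hi =>
    three_mul_le_partialWeight hx (fun y hy => hxw ▸ hmax ⟨y, hy, rfl⟩) hi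
  obtain ⟨h0, hout, h1⟩ := hx
  set S := {i ∈ H.verts | 0 < x i} with hS
  set E := {e ∈ H.edges | e ⊆ S} with hE
  have hES : E ⊆ S.powersetCard 3 := fun e he => by
    obtain ⟨he, hes⟩ := mem_filter.1 he
    exact mem_powersetCard.2 ⟨hes, (mem_powersetCard.1 (H.edges_subset he)).2⟩
  have hzero : ∀ e, ¬ e ⊆ S → ∃ j ∈ e, x j = 0 := by
    intro e he
    obtain ⟨j, hj, hjS⟩ := not_subset.1 he
    refine ⟨j, hj, ?_⟩
    by_cases hv : j ∈ H.verts
    · by_contra h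
      exact hjS (mem_filter.2 ⟨hv, lt_of_le_of_ne (h0 j hv) (Ne.symm h)⟩)
    · exact hout j hv
  have hw : ∑ e ∈ E, ∏ i ∈ e, x i = H.weight x := by
    rw [hE, weight, sum_filter]
    refine sum_congr rfl fun e _ => ?_
    split_ifs with h
    · rfl
    · obtain ⟨j, hj, hxj⟩ := hzero e h
      exact (prod_eq_zero hj hxj).symm
  have hd : ∀ i ∈ S, partialWeight E x i = partialWeight H.edges x i := by
    intro i hi
    rw [partialWeight, partialWeight, hE, filter_comm, sum_filter]
    refine sum_congr rfl fun e _ => ?_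
    split_ifs with h
    · rfl
    · obtain ⟨j, hj, hxj⟩ := hzero e h
      refine (prod_eq_zero (mem_erase.2 ⟨?_, hj⟩) hxj).symm
      rintro rfl
      exact (mem_filter.1 hi).2.ne' hxj
  have hdeg : ∀ i ∈ S, 3 * ∑ e ∈ E, ∏ i ∈ e, x i ≤ partialWeight E x i := fun i hi => by
    rw [hw, hd i hi]; exact hkkt i (mem_filter.1 hi).2
  have hcard : #E ≤ #H.edges := card_filter_le _ _
  refine ⟨S, E, x, hES, hcard, fun i hi => (mem_filter.1 hi).2, ?_, hw.trans hxw, hdeg, ?_⟩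
  · rw [← h1]
    refine sum_subset (filter_subset _ _) fun i hi hiS => ?_
    by_contra h
    exact hiS (mem_filter.2 ⟨hi, lt_of_le_of_ne (h0 i hi) (Ne.symm h)⟩)
  -- By the optimality condition every vertex of the support lies in an edge.
  · refine le_trans ?_ (Nat.mul_le_mul_left 3 hcard)
    rw [← sum_card_mem hES, card_eq_sum_ones]
    refine sum_le_sum fun i hi => ?_
    by_contra! hlt
    have h := hdeg i hi
    rw [partialWeight, card_eq_zero.1 (Nat.lt_one_iff.1 hlt), sum_empty, hw, hxw] at h
    linarith

/-- Padding with vertices of weight zero and sorting. -/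
theorem exists_sorted_weighting {S : Finset ℕ} {t : ℕ} (hS : #S ≤ t) {x : ℕ → ℝ}
    {E : Finset (Finset ℕ)} (hE : E ⊆ S.powersetCard 3) (h0 : ∀ i ∈ S, 0 ≤ x i)
    (h1 : ∑ i ∈ S, x i = 1) :
    ∃ (y : ℕ → ℝ) (E' : Finset (Finset ℕ)), (∀ i < t, 0 ≤ y i) ∧
      (∀ i j, i ≤ j → j < t → y i ≤ y j) ∧ ∑ i ∈ range t, y i = 1 ∧
      E' ⊆ (range t).powersetCard 3 ∧ #E' = #E ∧
      ∑ e ∈ E', ∏ i ∈ e, y i = ∑ e ∈ E, ∏ i ∈ e, x i := by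
  obtain ⟨S', hSS', hS'⟩ := Infinite.exists_superset_card_eq S t hS
  let z : ℕ → ℝ := fun i => if i ∈ S then x i else 0
  have hz : ∀ i, 0 ≤ z i := fun i => by
    by_cases h : i ∈ S
    · simpa [z, h] using h0 i h
    · simp [z, h]
  obtain ⟨f, himg, hinj, hmono, E', hE', hcard, hsum⟩ :=
    exists_sorted_relabelling hS' z (hE.trans (powersetCard_mono hSS'))
  refine ⟨fun i => z (f i), E', fun i _ => hz _, hmono, ?_, hE', hcard, hsum.trans ?_⟩
  · rw [← sum_image (f := z) hinj, himg, ← h1, ← sum_subset hSS' fun i _ hi => if_neg hi]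
    exact sum_congr rfl fun i hi => if_pos hi
  · exact sum_congr rfl fun e he => prod_congr rfl fun i hi =>
      if_pos ((mem_powersetCard.1 (hE he)).1 hi)

/-- A crude bound for the finitely many small `m`: the colex graph contains a clique large enough to
hold the whole support. -/
theorem lagrangian_le_of_choose_le {H : RGraph ℕ 3} {M : ℕ}
    (hM : (3 * #H.edges + 3).choose 3 ≤ M) : H.lagrangian ≤ (colexGraph 3 M).lagrangian := by
  rcases le_or_gt H.lagrangian 0 with h | h
  · exact h.trans (RGraph.lagrangian_nonneg _)
  obtain ⟨S, E, x, hE, -, hpos, h1, hw, -, hS⟩ := RGraph.exists_optimal_support h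
  obtain ⟨y, E', hy0, -, hy1, hE', -, hsum⟩ := exists_sorted_weighting
    (hS.trans (Nat.le_add_right _ 3)) hE (fun i hi => (hpos i hi).le) h1
  rw [← hw, ← hsum]
  refine le_trans ?_ (clique_sum_le_lagrangian (by omega) hM hy0 hy1)
  exact sum_le_sum_of_subset_of_nonneg hE' fun e he _ => prod_nonneg fun i hi =>
    hy0 i (mem_range.1 ((mem_powersetCard.1 he).1 hi))

theorem lagrangian_le_lagrangian_colexGraph {n u M : ℕ} (hn : 10 ^ 9 ≤ n) {H : RGraph ℕ 3}
    (hlow : (n + 1).choose 3 ≤ #H.edges) (hup : #H.edges ≤ (n + 2).choose 3)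
    (hu : n + 2 ≤ u ^ 3) (hu8 : u ^ 3 ≤ 8 * (n + 2)) (hM : #H.edges + 120 * u ^ 2 ≤ M) :
    H.lagrangian ≤ (colexGraph 3 M).lagrangian := by
  rcases le_or_gt H.lagrangian 0 with h | h
  · exact h.trans (RGraph.lagrangian_nonneg _)
  have hu2 : 120 * u ^ 2 ≤ n + 2 := by
    have hu1 : 960 ≤ u := by
      by_contra! hlt
      have := Nat.pow_le_pow_left hlt.le 3
      omega
    have : 960 * u ^ 2 ≤ u ^ 3 := by
      rw [pow_succ u 2, mul_comm]
      exact Nat.mul_le_mul_left _ hu1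
    omega
  obtain ⟨S, E, x, hE, hEH, hpos, h1, hw, hd, -⟩ := RGraph.exists_optimal_support h
  have hn' : (0 : ℝ) < n := by
    have : 0 < n := by omega
    exact_mod_cast this
  -- The threshold is six times the weight of the uniformly weighted clique on `n + 1` vertices.
  rcases lt_or_ge (6 * ∑ e ∈ E, ∏ i ∈ e, x i)
    ((((n + 2 : ℕ) : ℝ) - 2) * ((n + 2 : ℕ) - 3) / ((n + 2 : ℕ) - 1) ^ 2) with hlt | hge
  · have hs0 : (0 : ℝ) ≤ 1 / (n + 1) := by positivity
    have hs1 : (1 : ℝ) / (n + 1) ≤ 1 := by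
      rw [div_le_one (by linarith)]
      linarith
    refine le_trans ?_ (cliqueWeight_le_lagrangian (n := n) (by omega) (by omega : _ ≤ M) hs0 hs1)
    have e : 6 * cliqueWeight n (1 / (n + 1)) =
        (((n + 2 : ℕ) : ℝ) - 2) * ((n + 2 : ℕ) - 3) / ((n + 2 : ℕ) - 1) ^ 2 := by
      have hr : (1 - 1 / ((n : ℝ) + 1)) / n = 1 / (n + 1) := by field_simp; ring
      rw [cliqueWeight, hr]
      push_cast
      have h3 : (n : ℝ) + 2 - 1 = n + 1 := by ring
      rw [h3]
      field_simp
      ring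
    linarith
  · have hSt := card_support_le (t := n + 2) (by omega) hE (hEH.trans hup) hpos h1 hge hd
    obtain ⟨y, E', hy0, hymono, hy1, hE', hcard, hsum⟩ :=
      exists_sorted_weighting hSt hE (fun i hi => (hpos i hi).le) h1
    -- The cap keeps `p = O(t)`, as the fibre bound needs. Where it is active, `p - 120 * u ^ 2 ≥ n`
    -- and the clique on `n + 1` vertices already suffices.
    set p := min ((n + 2).choose 3 - #H.edges) (2 * (n + 2)) with hp
    have hmain := sum_prod_le_of_sorted (p := p) (by omega) hy0 hymono hy1 hE' (by omega)
      (by omega) hu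
    rw [hsum, hw] at hmain
    have ha := hy0 0 (by omega)
    have hb := hy0 1 (by omega)
    have hs1 : y 0 + y 1 ≤ 1 := by
      rw [sum_range_add_two] at hy1
      have : 0 ≤ ∑ i ∈ range n, y (i + 2) :=
        sum_nonneg fun j hj => hy0 _ (by have := mem_range.1 hj; omega)
      linarith
    have hab : 0 ≤ y 0 * y 1 * (1 - (y 0 + y 1)) := mul_nonneg (mul_nonneg ha hb) (by linarith)
    rcases le_or_gt n (p - 120 * u ^ 2) with hp' | hp'
    · refine le_trans ?_ (cliqueWeight_le_lagrangian (n := n) (by omega) (by omega : _ ≤ M)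
        (add_nonneg ha hb) hs1)
      have : 1 - ((p - 120 * u ^ 2 : ℕ) : ℝ) / n ≤ 0 := by
        rw [sub_nonpos, one_le_div hn']
        exact_mod_cast hp'
      nlinarith
    · refine le_trans ?_ (brokenWeight_le_lagrangian (n := n) (by omega) hp'.le
        (by omega : _ ≤ M + _) (add_nonneg ha hb) hs1)
      refine hmain.trans (add_le_add_right ?_ _)
      refine mul_le_mul_of_nonneg_right (mul_le_mul_of_nonneg_right ?_ (by linarith)) ?_
      · nlinarith [sq_nonneg (y 0 - y 1)]
      · rw [sub_nonneg, div_le_one hn']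
        exact_mod_cast hp'.le

/-! ### Choice of parameters and conclusion. -/

theorem exists_choose_three_bracket {n₀ m : ℕ} (hm : (n₀ + 2).choose 3 ≤ m) :
    ∃ n, n₀ < n ∧ (n + 1).choose 3 ≤ m ∧ m < (n + 2).choose 3 := by
  have hex : ∃ k : ℕ, m < k.choose 3 := by
    refine ⟨m + 3, ?_⟩
    have : (m : ℝ) < ((m + 3).choose 3 : ℕ) := by
      rw [cast_choose_three]
      push_cast
      have : (0 : ℝ) ≤ m := Nat.cast_nonneg m
      nlinarith [mul_nonneg this this, mul_nonneg (mul_nonneg this this) this]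
    exact_mod_cast this
  have hlt : n₀ + 2 < Nat.find hex := by
    by_contra! h
    have := Nat.find_spec hex
    have := Nat.choose_le_choose 3 h
    omega
  obtain ⟨n, hn⟩ : ∃ n, Nat.find hex = n + 2 := ⟨Nat.find hex - 2, by omega⟩
  refine ⟨n, by omega, not_lt.1 (Nat.find_min hex (by omega)), ?_⟩
  have := Nat.find_spec hex
  rwa [hn] at this

theorem exists_cube_bracket {t : ℕ} (ht : 2 ≤ t) : ∃ u, t ≤ u ^ 3 ∧ u ^ 3 ≤ 8 * t := by
  have hex : ∃ u, t ≤ u ^ 3 := ⟨t, Nat.le_self_pow (by norm_num) t⟩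
  refine ⟨Nat.find hex, Nat.find_spec hex, ?_⟩
  have h1 : 2 ≤ Nat.find hex := by
    by_contra! h
    have h2 := Nat.find_spec hex
    have h3 := Nat.pow_le_pow_left (Nat.lt_succ_iff.1 h) 3
    omega
  obtain ⟨v, hv⟩ : ∃ v, Nat.find hex = v + 1 := ⟨Nat.find hex - 1, by omega⟩
  have h2 := not_le.1 (Nat.find_min hex (m := v) (by omega))
  have h3 : (v + 1) ^ 3 ≤ (2 * v) ^ 3 := Nat.pow_le_pow_left (by omega) 3
  rw [mul_pow] at h3
  rw [hv]
  omega

theorem sq_le_rpow_of_cube_le {n m u : ℕ} (hn : 12 ≤ n) (hm : (n + 1).choose 3 ≤ m)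
    (hu : u ^ 3 ≤ 8 * (n + 2)) : (u : ℝ) ^ 2 ≤ 9 * (m : ℝ) ^ (2 / 9 : ℝ) := by
  have hn' : (12 : ℝ) ≤ n := by exact_mod_cast hn
  have hu' : (u : ℝ) ^ 3 ≤ 8 * (n + 2) := by exact_mod_cast hu
  have hm' : ((n : ℝ) + 1) * n * (n - 1) / 6 ≤ m := by
    have h := cast_choose_three (n + 1)
    push_cast at h
    have h2 : (((n + 1).choose 3 : ℕ) : ℝ) ≤ m := by exact_mod_cast hm
    rw [h] at h2
    linarith
  have h9 : (u : ℝ) ^ 9 ≤ 3 ^ 9 * m := by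
    calc (u : ℝ) ^ 9 = (u ^ 3) ^ 3 := by ring
      _ ≤ (8 * ((n : ℝ) + 2)) ^ 3 := pow_le_pow_left₀ (by positivity) hu' 3
      _ ≤ 3 ^ 9 * (((n : ℝ) + 1) * n * (n - 1) / 6) := by
        nlinarith [mul_le_mul_of_nonneg_right hn' (sq_nonneg (n : ℝ))]
      _ ≤ 3 ^ 9 * m := by linarith
  set v : ℝ := (m : ℝ) ^ (1 / 9 : ℝ) with hv
  have hv0 : 0 ≤ v := by positivity
  have hv9 : v ^ 9 = m := by
    rw [hv, ← Real.rpow_natCast, ← Real.rpow_mul (Nat.cast_nonneg m)]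
    norm_num
  have hv2 : v ^ 2 = (m : ℝ) ^ (2 / 9 : ℝ) := by
    rw [hv, ← Real.rpow_natCast, ← Real.rpow_mul (Nat.cast_nonneg m)]
    norm_num
  have huv : (u : ℝ) ≤ 3 * v := by
    refine le_of_pow_le_pow_left₀ (n := 9) (by norm_num) (by positivity) ?_
    rw [mul_pow, hv9]
    exact h9
  rw [← hv2]
  calc (u : ℝ) ^ 2 ≤ (3 * v) ^ 2 := pow_le_pow_left₀ (Nat.cast_nonneg u) huv 2
    _ = 9 * v ^ 2 := by ring

theorem exists_threshold : ∃ m₀ : ℕ, ∀ H : RGraph ℕ 3, m₀ ≤ #H.edges → ∀ M : ℕ,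
    (#H.edges : ℝ) + 1080 * (#H.edges : ℝ) ^ (2 / 9 : ℝ) ≤ M →
      H.lagrangian ≤ (colexGraph 3 M).lagrangian := by
  refine ⟨(10 ^ 9 + 2).choose 3, fun H hH M hM => ?_⟩
  obtain ⟨n, hn, hlow, hup⟩ := exists_choose_three_bracket hH
  obtain ⟨u, hu, hu8⟩ := exists_cube_bracket (t := n + 2) (by omega)
  refine lagrangian_le_lagrangian_colexGraph hn.le hlow hup.le hu hu8 ?_
  have h := sq_le_rpow_of_cube_le (by omega) hlow hu8
  have : ((#H.edges + 120 * u ^ 2 : ℕ) : ℝ) ≤ M := by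
    push_cast
    linarith
  exact_mod_cast this

theorem theorem3 :
    ∃ c : ℝ, 0 < c ∧ ∀ m : ℕ, 0 < m →
      maxLagrangian 3 m ≤
        (colexGraph 3 ⌊(m : ℝ) + c * (m : ℝ) ^ (2 / 9 : ℝ)⌋₊).lagrangian := by
  obtain ⟨m₀, hm₀⟩ := exists_threshold
  set B := (3 * m₀ + 3).choose 3 with hB
  -- `1080 = 120 * 9` serves large `m`, the extra `1` pays for the floor, and `B` covers `m < m₀`.
  refine ⟨B + 1081, by positivity, fun m hm => Real.sSup_le ?_ (RGraph.lagrangian_nonneg _)⟩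
  rintro _ ⟨H, rfl, rfl⟩
  have hpow : 1 ≤ (#H.edges : ℝ) ^ (2 / 9 : ℝ) :=
    Real.one_le_rpow (by exact_mod_cast hm) (by norm_num)
  have hB0 : (0 : ℝ) ≤ B := Nat.cast_nonneg _
  rcases le_or_gt m₀ #H.edges with h | h
  · refine hm₀ H h _ ?_
    refine le_trans ?_ (Nat.sub_one_lt_floor _).le
    nlinarith
  · refine lagrangian_le_of_choose_le ((Nat.choose_le_choose 3
      (by omega : 3 * #H.edges + 3 ≤ 3 * m₀ + 3)).trans (Nat.le_floor ?_))
    have : (0 : ℝ) ≤ #H.edges := Nat.cast_nonneg _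
    nlinarith
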